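/- Conventions. All Hilbert spaces are complex, inner products are antilinear in the first argument, $\otimes$ is the Hilbert space tensor product, and $\mathcal{H}_{AB}=\mathcal{H}_A\otimes\mathcal{H}_B$. $\mathfrak{T}(\mathcal{H})$ is the space of trace class operators on $\mathcal{H}$. A CPTP map $\Phi:\mathfrak{T}(\mathcal{H})\to\mathfrak{T}(\mathcal{K})$ is a completely positive, trace-preserving linear map. Given an orthonormal basis $\{|i\rangle\}$ of $\mathcal{H}$ put $\bar\psi=\sum_i\overline{\langle i|\psi\rangle}\,|i\rangle$; the Choi–Jamiołkowski representation of $\Phi$ is the sesquilinear form on the algebraic span of the simple tensors in $\mathcal{K}\otimes\mathcal{H}$ with $R_\Phi(k\otimes h;k'\otimes h')=\langle k|\,\Phi(|\bar h\rangle\langle\bar h'|)\,|k'\rangle$. A Stinespring representation of $\Phi$ with ancilla $\mathcal{R}$ is a bounded operator $U:\mathcal{H}\to\mathcal{K}\otimes\mathcal{R}$ with $\Phi(\rho)=\mathrm{tr}_{\mathcal R}(U\rho U^*)$ for all $\rho$ (it is then an isometry); it is minimal if the vectors $(X\otimes I_{\mathcal R})Uh$, $X$ a bounded operator on $\mathcal{K}$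 and $h\in\mathcal{H}$, span a dense subspace of $\mathcal{K}\otimes\mathcal{R}$. Lemma. Let $\mathcal{H}_A,\mathcal{H}_B,\mathcal{H}_C,\mathcal{H}_D$ be Hilbert spaces with $\mathcal{H}_C\neq 0$, let $\Phi:\mathfrak{T}(\mathcal{H}_{AB})\to\mathfrak{T}(\mathcal{H}_{CD})$ and $\Psi:\mathfrak{T}(\mathcal{H}_A)\to\mathfrak{T}(\mathcal{H}_C)$ be CPTP maps, and let orthonormal bases of $\mathcal{H}_A$ and $\mathcal{H}_B$ be given; conjugation on $\mathcal{H}_{AB}$ is taken with respect to the product basis. The following are equivalent: (0) $\mathrm{tr}_D\circ\Phi=\Psi\circ\mathrm{tr}_B$. (1) For all $\psi_A,\varphi_A\in\mathcal{H}_A$, $\psi_B,\varphi_B\in\mathcal{H}_B$, $\psi_C,\varphi_C\in\mathcal{H}_C$ and every orthonormal basis $\{|j\rangle\}_j$ of $\mathcal{H}_D$, the sum on the left converges and $$\sum_j R_\Phi(\psi_C\otimes j\otimes\psi_A\otimes\psi_B;\varphi_C\otimes j\otimes\varphi_A\otimes\varphi_B)=R_\Psi(\psi_C\otimes\psi_A;\varphi_C\otimes\varphi_A)\,\langle\psi_B|\varphi_B\rangle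 .$$ (2) For all minimal Stinespring representations $U_\Phi:\mathcal{H}_{AB}\to\mathcal{H}_{CD}\otimes\mathcal{H}_R$ of $\Phi$ and $U_\Psi:\mathcal{H}_A\to\mathcal{H}_C\otimes\mathcal{H}_Q$ of $\Psi$ there is an isometry $V:\mathcal{H}_{QB}\to\mathcal{H}_{DR}$ with $U_\Phi=(I_C\otimes V)(U_\Psi\otimes I_B)$. (2') There exist such minimal representations $U_\Phi$, $U_\Psi$ and an isometry $V:\mathcal{H}_{QB}\to\mathcal{H}_{DR}$ with $U_\Phi=(I_C\otimes V)(U_\Psi\otimes I_B)$. Setting for the corollary. Let $\mathcal{T}$ be a countable partially ordered set. A cut is a subset $\mathcal{C}\subseteq\mathcal{T}$ that contains with $t$ every $p\le t$; it is bounded if $\mathcal{C}\subseteq\{p: p\le t\}$ for some $t\in\mathcal{T}$. A causality function is a map $\chi$ from cuts to cuts such that $\chi(\mathcal{C}\cup\mathcal{D})=\chi(\mathcal{C})\cup\chi(\mathcal{D})$; $\mathcal{C}\subseteq\mathcal{D}$ implies $\chi(\mathcal{C})\subseteq\chi(\mathcal{D})$; $\chi(\mathcal{C})\subsetneq\mathcal{C}$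 for every nonempty bounded cut $\mathcal{C}$; and for every bounded cut $\mathcal{C}$ and $t\in\mathcal{C}$ there is $n$ with $t\notin\chi^n(\mathcal{C})$. For $\mathcal{P}\subseteq\mathcal{T}$ and a wire $X$ of dimension $d_X\in\mathbb{N}$, let $\mathcal{F}_X^{\mathcal{P}}=\bigoplus_{n\ge0}\vee^n(\ell^2(\mathcal{P})\otimes\mathbb{C}^{d_X})$ be the bosonic Fock space; it has an orthonormal basis $|m\rangle$ indexed by the finite multisets $m$ of pairs of a position in $\mathcal{P}$ and a message in $\{1,\dots,d_X\}$, which is used for complex conjugation. For $\mathcal{P}\subseteq\mathcal{Q}$ identify $\mathcal{F}_X^{\mathcal{Q}}\cong\mathcal{F}_X^{\mathcal{P}}\otimes\mathcal{F}_X^{\mathcal{Q}\setminus\mathcal{P}}$ by $|m+m'\rangle\cong|m\rangle\otimes|m'\rangle$, and let $\mathrm{tr}_{\mathcal{Q}\setminus\mathcal{P}}$ trace out the second factor. Corollary. Let $\chi$ be a causality function and let $\Phi^{\mathcal{C}}:\mathfrak{T}(\mathcal{F}_X^{\chi(\mathcal{C})})\to\mathfrak{T}(\mathcal{F}_Y^{\mathcal{C}})$,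 for $\mathcal{C}$ ranging over the bounded cuts, be CPTP maps. For all bounded cuts $\mathcal{C}\subseteq\mathcal{D}$, with $\tilde\chi=\chi(\mathcal{D})\setminus\chi(\mathcal{C})$ and $\tilde{\mathcal{C}}=\mathcal{D}\setminus\mathcal{C}$, the following are equivalent: (1) $\mathrm{tr}_{\tilde{\mathcal{C}}}\circ\Phi^{\mathcal{D}}=\Phi^{\mathcal{C}}\circ\mathrm{tr}_{\tilde\chi}$ (the causality condition). (2) For all $\psi,\varphi\in\mathcal{F}_X^{\chi(\mathcal{C})}$, $\psi',\varphi'\in\mathcal{F}_X^{\tilde\chi}$, $\psi_Y,\varphi_Y\in\mathcal{F}_Y^{\mathcal{C}}$ and every orthonormal basis $\{|j\rangle\}_j$ of $\mathcal{F}_Y^{\tilde{\mathcal{C}}}$, the sum on the left converges and $$\sum_j R_{\Phi^{\mathcal{D}}}(\psi_Y\otimes j\otimes\psi\otimes\psi';\varphi_Y\otimes j\otimes\varphi\otimes\varphi')=R_{\Phi^{\mathcal{C}}}(\psi_Y\otimes\psi;\varphi_Y\otimes\varphi)\,\langle\psi'|\varphi'\rangle .$$ (3) For all minimal Stinespring representations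 $U^{\mathcal{D}}:\mathcal{F}_X^{\chi(\mathcal{D})}\to\mathcal{F}_Y^{\mathcal{D}}\otimes\mathcal{H}_R$ of $\Phi^{\mathcal{D}}$ and $U^{\mathcal{C}}:\mathcal{F}_X^{\chi(\mathcal{C})}\to\mathcal{F}_Y^{\mathcal{C}}\otimes\mathcal{H}_Q$ of $\Phi^{\mathcal{C}}$ there is an isometry $V:\mathcal{H}_Q\otimes\mathcal{F}_X^{\tilde\chi}\to\mathcal{F}_Y^{\tilde{\mathcal{C}}}\otimes\mathcal{H}_R$ with $U^{\mathcal{D}}=(I\otimes V)(U^{\mathcal{C}}\otimes I)$. (3') There exist such minimal representations $U^{\mathcal{D}}$, $U^{\mathcal{C}}$ and an isometry $V:\mathcal{H}_Q\otimes\mathcal{F}_X^{\tilde\chi}\to\mathcal{F}_Y^{\tilde{\mathcal{C}}}\otimes\mathcal{H}_R$ with $U^{\mathcal{D}}=(I\otimes V)(U^{\mathcal{C}}\otimes I)$. -/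

import Mathlib

set_option linter.unusedSectionVars false

open scoped TensorProduct ComplexOrder

noncomputable section

namespace CausalBox

/-! ### Hilbert space tensor product -/

section HilbertTensor

variable {E F G H : Type*}
  [NormedAddCommGroup E] [InnerProductSpace ℂ E] [NormedAddCommGroup F] [InnerProductSpace ℂ F]
  [NormedAddCommGroup G] [InnerProductSpace ℂ G] [NormedAddCommGroup H] [InnerProductSpace ℂ H]

/-- The Hilbert space tensor product: the completion of the algebraic tensor product for the inner
product with `⟪x ⊗ y, x' ⊗ y'⟫ = ⟪x, x'⟫ * ⟪y, y'⟫`. -/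
def HTensor (E F : Type*) [NormedAddCommGroup E] [InnerProductSpace ℂ E]
    [NormedAddCommGroup F] [InnerProductSpace ℂ F] : Type _ :=
  UniformSpace.Completion (E ⊗[ℂ] F)

instance : NormedAddCommGroup (HTensor E F) :=
  inferInstanceAs (NormedAddCommGroup (UniformSpace.Completion (E ⊗[ℂ] F)))

instance : InnerProductSpace ℂ (HTensor E F) :=
  inferInstanceAs (InnerProductSpace ℂ (UniformSpace.Completion (E ⊗[ℂ] F)))

instance : CompleteSpace (HTensor E F) :=
  inferInstanceAs (CompleteSpace (UniformSpace.Completion (E ⊗[ℂ] F)))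

/-- The inclusion of the algebraic tensor product. -/
def hcoe (E F : Type*) [NormedAddCommGroup E] [InnerProductSpace ℂ E]
    [NormedAddCommGroup F] [InnerProductSpace ℂ F] : E ⊗[ℂ] F →ₗᵢ[ℂ] HTensor E F :=
  (UniformSpace.Completion.toComplₗᵢ :
    E ⊗[ℂ] F →ₗᵢ[ℂ] UniformSpace.Completion (E ⊗[ℂ] F))

theorem denseRange_hcoe : DenseRange (hcoe E F) :=
  UniformSpace.Completion.denseRange_coe (α := E ⊗[ℂ] F)

/-- The simple tensor `x ⊗ y` in the Hilbert space tensor product, as a bounded bilinear map. -/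
def htmulL (E F : Type*) [NormedAddCommGroup E] [InnerProductSpace ℂ E]
    [NormedAddCommGroup F] [InnerProductSpace ℂ F] : E →L[ℂ] F →L[ℂ] HTensor E F :=
  (ContinuousLinearMap.compL ℂ F (E ⊗[ℂ] F) (HTensor E F) (hcoe E F).toContinuousLinearMap) ∘L
    TensorProduct.mkL ℂ E F

/-- The simple tensor `x ⊗ y` in the Hilbert space tensor product. -/
def htmul (x : E) (y : F) : HTensor E F := htmulL E F x y

theorem htmul_eq (x : E) (y : F) : htmul x y = hcoe E F (x ⊗ₜ[ℂ] y) := rfl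

theorem inner_htmul (x x' : E) (y y' : F) :
    inner ℂ (htmul x y) (htmul x' y') = inner ℂ x x' * inner ℂ y y' := by
  rw [htmul_eq, htmul_eq, LinearIsometry.inner_map_map, TensorProduct.inner_tmul]

/-- The tensor product `f ⊗ g` of two bounded operators. -/
def hmap (f : E →L[ℂ] G) (g : F →L[ℂ] H) : HTensor E F →L[ℂ] HTensor G H :=
  ((TensorProduct.mapL f g).completion :
    UniformSpace.Completion (E ⊗[ℂ] F) →L[ℂ] UniformSpace.Completion (G ⊗[ℂ] H))

theorem hmap_hcoe (f : E →L[ℂ] G) (g : F →L[ℂ] H) (t : E ⊗[ℂ] F) :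
    hmap f g (hcoe E F t) = hcoe G H (TensorProduct.mapL f g t) :=
  ContinuousLinearMap.completion_apply_coe (TensorProduct.mapL f g) t

theorem hmap_htmul (f : E →L[ℂ] G) (g : F →L[ℂ] H) (x : E) (y : F) :
    hmap f g (htmul x y) = htmul (f x) (g y) := by
  rw [htmul_eq, hmap_hcoe, TensorProduct.mapL_tmul, htmul_eq]

theorem dense_span_htmul {S : Set E} {T : Set F} (hS : Dense (Submodule.span ℂ S : Set E))
    (hT : Dense (Submodule.span ℂ T : Set F)) :
    (Submodule.span ℂ (Set.image2 htmul S T)).topologicalClosure =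
      (⊤ : Submodule ℂ (HTensor E F)) := by
  have h1 : ∀ x ∈ S, ∀ y : F,
      htmul x y ∈ (Submodule.span ℂ (Set.image2 htmul S T)).topologicalClosure := by
    intro x hx y
    have hc : IsClosed {y : F | htmul x y ∈
        (Submodule.span ℂ (Set.image2 htmul S T)).topologicalClosure} :=
      (Submodule.isClosed_topologicalClosure _).preimage (htmulL E F x).continuous
    refine hc.closure_subset_iff.2 ?_ (hT y)
    intro y hy
    induction hy using Submodule.span_induction with
    | mem y hy =>
      exact Submodule.le_topologicalClosure _ (Submodule.subset_span ⟨x, hx, y, hy, rfl⟩)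
    | zero => simp [htmul]
    | add a b _ _ ha hb =>
      rw [Set.mem_ofPred_eq] at ha hb ⊢
      simpa [htmul] using Submodule.add_mem _ ha hb
    | smul c a _ ha =>
      rw [Set.mem_ofPred_eq] at ha ⊢
      simpa [htmul] using Submodule.smul_mem _ c ha
  have h2 : ∀ (x : E) (y : F),
      htmul x y ∈ (Submodule.span ℂ (Set.image2 htmul S T)).topologicalClosure := by
    intro x y
    have hc : IsClosed {x : E | htmul x y ∈
        (Submodule.span ℂ (Set.image2 htmul S T)).topologicalClosure} :=
      (Submodule.isClosed_topologicalClosure _).preimage ((htmulL E F).flip y).continuous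
    refine hc.closure_subset_iff.2 ?_ (hS x)
    intro x hx
    induction hx using Submodule.span_induction with
    | mem x hx => exact h1 x hx y
    | zero => simp [htmul]
    | add a b _ _ ha hb =>
      rw [Set.mem_ofPred_eq] at ha hb ⊢
      simpa [htmul] using Submodule.add_mem _ ha hb
    | smul c a _ ha =>
      rw [Set.mem_ofPred_eq] at ha ⊢
      simpa [htmul] using Submodule.smul_mem _ c ha
  rw [eq_top_iff]
  intro z _
  refine (Submodule.isClosed_topologicalClosure _).closure_subset_iff.2 ?_ (denseRange_hcoe z)
  rintro _ ⟨t, rfl⟩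
  induction t with
  | zero =>
    rw [map_zero]
    exact Submodule.zero_mem _
  | tmul x y => exact h2 x y
  | add a b ha hb =>
    rw [map_add]
    exact Submodule.add_mem _ ha hb

/-- Triple simple tensors, bracketed to the left. -/
def hcoeLeft (E F G : Type*) [NormedAddCommGroup E] [InnerProductSpace ℂ E]
    [NormedAddCommGroup F] [InnerProductSpace ℂ F] [NormedAddCommGroup G] [InnerProductSpace ℂ G] :
    (E ⊗[ℂ] F) ⊗[ℂ] G →ₗᵢ[ℂ] HTensor (HTensor E F) G :=
  (hcoe (HTensor E F) G).comp (TensorProduct.mapIsometry (hcoe E F) LinearIsometry.id)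

/-- Triple simple tensors, bracketed to the right. -/
def hcoeRight (E F G : Type*) [NormedAddCommGroup E] [InnerProductSpace ℂ E]
    [NormedAddCommGroup F] [InnerProductSpace ℂ F] [NormedAddCommGroup G] [InnerProductSpace ℂ G] :
    E ⊗[ℂ] (F ⊗[ℂ] G) →ₗᵢ[ℂ] HTensor E (HTensor F G) :=
  (hcoe E (HTensor F G)).comp (TensorProduct.mapIsometry LinearIsometry.id (hcoe F G))

theorem denseRange_of_span {M : Type*} [AddCommGroup M] [Module ℂ M] (f : M →ₗ[ℂ] E)
    {S : Set E} (hS : (Submodule.span ℂ S).topologicalClosure = ⊤)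
    (h : S ⊆ Set.range f) : DenseRange f := by
  have h1 : (Submodule.span ℂ S : Set E) ⊆ Set.range f := by
    rw [← LinearMap.coe_range]
    exact Submodule.span_le.2 h
  exact ((Submodule.dense_iff_topologicalClosure_eq_top).2 hS).mono h1

theorem dense_span_range_htmul :
    Dense (Submodule.span ℂ (Set.image2 (htmul (E := E) (F := F)) Set.univ Set.univ) :
      Set (HTensor E F)) := by
  rw [Submodule.dense_iff_topologicalClosure_eq_top]
  exact dense_span_htmul (by simp) (by simp)

theorem denseRange_hcoeLeft : DenseRange (hcoeLeft E F G).toLinearMap := by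
  refine denseRange_of_span _
    (dense_span_htmul (T := Set.univ) dense_span_range_htmul (by simp)) ?_
  rintro _ ⟨_, ⟨x, -, y, -, rfl⟩, z, -, rfl⟩
  exact ⟨(x ⊗ₜ[ℂ] y) ⊗ₜ[ℂ] z, rfl⟩

theorem denseRange_hcoeRight : DenseRange (hcoeRight E F G).toLinearMap := by
  refine denseRange_of_span _
    (dense_span_htmul (S := Set.univ) (by simp) dense_span_range_htmul) ?_
  rintro _ ⟨x, -, _, ⟨y, -, z, -, rfl⟩, rfl⟩
  exact ⟨x ⊗ₜ[ℂ] (y ⊗ₜ[ℂ] z), rfl⟩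

/-- The canonical unitary `(E ⊗ F) ⊗ G ≃ E ⊗ (F ⊗ G)`. -/
def hassoc (E F G : Type*) [NormedAddCommGroup E] [InnerProductSpace ℂ E]
    [NormedAddCommGroup F] [InnerProductSpace ℂ F] [NormedAddCommGroup G] [InnerProductSpace ℂ G] :
    HTensor (HTensor E F) G ≃ₗᵢ[ℂ] HTensor E (HTensor F G) :=
  (TensorProduct.assoc ℂ E F G).extendOfIsometry
    (hcoeLeft E F G).toLinearMap (hcoeRight E F G).toLinearMap
    denseRange_hcoeLeft denseRange_hcoeRight fun t => by
      change ‖hcoeRight E F G _‖ = ‖hcoeLeft E F G _‖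
      rw [LinearIsometry.norm_map, LinearIsometry.norm_map, TensorProduct.norm_assoc]

theorem hassoc_htmul (x : E) (y : F) (z : G) :
    hassoc E F G (htmul (htmul x y) z) = htmul x (htmul y z) :=
  LinearEquiv.extendOfIsometry_eq (TensorProduct.assoc ℂ E F G)
    (hcoeLeft E F G).toLinearMap (hcoeRight E F G).toLinearMap
    denseRange_hcoeLeft denseRange_hcoeRight _ ((x ⊗ₜ[ℂ] y) ⊗ₜ[ℂ] z)

/-- The orthonormal basis `a i ⊗ b j` of `E ⊗ F`. -/
def tensorBasis {ι κ : Type*} (a : HilbertBasis ι ℂ E) (b : HilbertBasis κ ℂ F) :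
    HilbertBasis (ι × κ) ℂ (HTensor E F) :=
  HilbertBasis.mk (v := fun p : ι × κ => htmul (a p.1) (b p.2))
    (by
      classical
      rw [orthonormal_iff_ite]
      rintro ⟨i, j⟩ ⟨i', j'⟩
      rw [inner_htmul, orthonormal_iff_ite.1 a.orthonormal, orthonormal_iff_ite.1 b.orthonormal]
      by_cases h1 : i = i' <;> by_cases h2 : j = j' <;> simp [h1, h2])
    (by
      rw [show Set.range (fun p : ι × κ => htmul (a p.1) (b p.2)) =
        Set.image2 htmul (Set.range a) (Set.range b) from
          (Set.image2_range htmul a b).symm]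
      exact (dense_span_htmul
        ((Submodule.dense_iff_topologicalClosure_eq_top).2 a.dense_span)
        ((Submodule.dense_iff_topologicalClosure_eq_top).2 b.dense_span)).ge)

theorem tensorBasis_apply {ι κ : Type*} (a : HilbertBasis ι ℂ E) (b : HilbertBasis κ ℂ F)
    (p : ι × κ) : tensorBasis a b p = htmul (a p.1) (b p.2) := by
  rw [tensorBasis, HilbertBasis.coe_mk]

end HilbertTensor

/-! ### Trace class operators -/

section TraceClass

variable {H K : Type*} [NormedAddCommGroup H] [InnerProductSpace ℂ H] [CompleteSpace H]
  [NormedAddCommGroup K] [InnerProductSpace ℂ K] [CompleteSpace K]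

/-- The index set of a fixed orthonormal basis of `H`. -/
def basisSet (H : Type*) [NormedAddCommGroup H] [InnerProductSpace ℂ H] [CompleteSpace H] :
    Set H :=
  (exists_hilbertBasis ℂ H).choose

/-- A fixed orthonormal basis of `H`. -/
def stdBasis (H : Type*) [NormedAddCommGroup H] [InnerProductSpace ℂ H] [CompleteSpace H] :
    HilbertBasis (basisSet H) ℂ H :=
  (exists_hilbertBasis ℂ H).choose_spec.choose

/-- `V` is trace class if `∑ i, ⟪i, |V| i⟫ < ∞` with `|V| = √(V⋆ V)`, for an orthonormal basis. -/
def IsTraceClass (V : H →L[ℂ] H) : Prop :=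
  Summable fun i => (inner ℂ (stdBasis H i) (CFC.abs V (stdBasis H i))).re

/-- `V = ∑ n, |x n⟩⟨y n|` with `∑ n, ‖x n‖ * ‖y n‖ < ∞`. -/
structure IsNuclearRep {ι : Type*} (V : H →L[ℂ] H) (x y : ι → H) : Prop where
  summable : Summable fun n => ‖x n‖ * ‖y n‖
  hasSum : ∀ v, HasSum (fun n => inner ℂ (y n) v • x n) (V v)

theorem sum_mul_le {ι : Type*} {f g : ι → ℝ} {a b : ℝ} (ha : 0 ≤ a) (hb : 0 ≤ b)
    (hf : ∀ s : Finset ι, ∑ i ∈ s, f i ^ 2 ≤ a ^ 2)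
    (hg : ∀ s : Finset ι, ∑ i ∈ s, g i ^ 2 ≤ b ^ 2) (s : Finset ι) :
    ∑ i ∈ s, f i * g i ≤ a * b := by
  refine le_of_abs_le (abs_le_of_sq_le_sq ?_ (mul_nonneg ha hb))
  refine (Finset.sum_mul_sq_le_sq_mul_sq s f g).trans ?_
  rw [mul_pow]
  exact mul_le_mul (hf s) (hg s) (Finset.sum_nonneg fun i _ => sq_nonneg _) (sq_nonneg _)

theorem summable_prod_of_sum_le {ι κ : Type*} {f : ι × κ → ℝ} {c : ι → ℝ} (hf : ∀ p, 0 ≤ f p)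
    (hc : Summable c) (h : ∀ n, ∀ s : Finset κ, ∑ j ∈ s, f (n, j) ≤ c n) : Summable f := by
  have h1 : ∀ n, Summable fun j => f (n, j) := fun n =>
    summable_of_sum_le (fun j => hf _) (h n)
  refine (summable_prod_of_nonneg hf).2 ⟨h1, ?_⟩
  exact Summable.of_nonneg_of_le (fun n => tsum_nonneg fun j => hf _)
    (fun n => (h1 n).tsum_le_of_sum_le (h n)) hc

theorem exists_factor {A B : H →L[ℂ] H} (h : ∀ x, ‖A x‖ = ‖B x‖) :
    ∃ W : H →L[ℂ] H, (∀ x, ‖W x‖ ≤ ‖x‖) ∧ ∀ x, A x = W (B x) := by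
  let K : Submodule ℂ H := (LinearMap.range B.toLinearMap).topologicalClosure
  have hK : CompleteSpace K :=
    (Submodule.isClosed_topologicalClosure _).completeSpace_coe
  let e : H →ₗ[ℂ] K := B.toLinearMap.codRestrict K
    fun x => Submodule.le_topologicalClosure _ ⟨x, rfl⟩
  have he : DenseRange e := by
    intro z
    have hz : (z : H) ∈ closure (Set.range B) := by
      have := z.2
      rwa [← SetLike.mem_coe, Submodule.topologicalClosure_coe, LinearMap.coe_range] at this
    rw [Topology.IsInducing.subtypeVal.closure_eq_preimage_closure_image]
    refine closure_mono ?_ hz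
    rintro _ ⟨x, rfl⟩
    exact ⟨e x, ⟨x, rfl⟩, rfl⟩
  have hn : ∀ x, ‖A.toLinearMap x‖ ≤ 1 * ‖e x‖ := fun x => by
    rw [one_mul]; exact (h x).le
  refine ⟨(A.toLinearMap.extendOfNorm e) ∘L K.orthogonalProjectionOnto, fun x => ?_, fun x => ?_⟩
  · refine (LinearMap.norm_extendOfNorm_apply_le he 1 hn _).trans ?_
    rw [one_mul]
    exact K.norm_orthogonalProjectionOnto_apply_le x
  · have h1 : K.orthogonalProjectionOnto (B x) = e x :=
      K.orthogonalProjectionOnto_mem_subspace_eq_self (e x)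
    rw [ContinuousLinearMap.comp_apply, h1, LinearMap.extendOfNorm_eq he ⟨1, hn⟩]
    rfl

theorem norm_sq_eq_of_star_mul {A B : H →L[ℂ] H} (h : star A * A = star B * B) (x : H) :
    ‖A x‖ = ‖B x‖ := by
  have key : ∀ C : H →L[ℂ] H, ‖C x‖ ^ 2 = (inner ℂ ((star C * C) x) x).re := fun C => by
    rw [ContinuousLinearMap.star_eq_adjoint]
    change _ = (inner ℂ (ContinuousLinearMap.adjoint C (C x)) x).re
    rw [ContinuousLinearMap.adjoint_inner_left, inner_self_eq_norm_sq_to_K]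
    norm_cast
  have h2 : ‖A x‖ ^ 2 = ‖B x‖ ^ 2 := by rw [key, key, h]
  exact (sq_eq_sq₀ (norm_nonneg _) (norm_nonneg _)).1 h2

theorem norm_abs_apply (V : H →L[ℂ] H) (x : H) : ‖CFC.abs V x‖ = ‖V x‖ := by
  refine norm_sq_eq_of_star_mul ?_ x
  rw [(CFC.abs_nonneg V).isSelfAdjoint.star_eq, CFC.abs_mul_abs]

theorem IsTraceClass.exists_rep {V : H →L[ℂ] H} (hV : IsTraceClass V) :
    ∃ x y : basisSet H → H, IsNuclearRep V x y := by
  obtain ⟨W, hW, hVW⟩ := exists_factor (fun x => (norm_abs_apply V x).symm)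
  set S : H →L[ℂ] H := CFC.sqrt (CFC.abs V) with hS
  have hSS : S * S = CFC.abs V := CFC.sqrt_mul_sqrt_self _ (CFC.abs_nonneg V)
  have hSa : IsSelfAdjoint S := (CFC.sqrt_nonneg _).isSelfAdjoint
  have hSin : ∀ u v, inner ℂ (S u) v = inner ℂ u (S v) := fun u v => by
    rw [← ContinuousLinearMap.adjoint_inner_right, ← ContinuousLinearMap.star_eq_adjoint,
      hSa.star_eq]
  have hnorm : ∀ i, ‖S (stdBasis H i)‖ * ‖S (stdBasis H i)‖ =
      (inner ℂ (stdBasis H i) (CFC.abs V (stdBasis H i))).re := fun i => by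
    rw [← hSS]
    change _ = (inner ℂ _ (S (S (stdBasis H i)))).re
    rw [← hSin, inner_self_eq_norm_sq_to_K, ← sq]
    norm_cast
  refine ⟨fun i => W (S (stdBasis H i)), fun i => S (stdBasis H i), ?_, fun v => ?_⟩
  · refine Summable.of_nonneg_of_le (fun i => by positivity) (fun i => ?_) hV
    rw [← hnorm]
    exact mul_le_mul_of_nonneg_right (hW _) (norm_nonneg _)
  · have h1 := (stdBasis H).hasSum_repr (S v)
    have h2 := (W ∘L S).hasSum h1
    have h3 : (W ∘L S) (S v) = V v := by
      rw [hVW, ← hSS]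
      rfl
    rw [h3] at h2
    convert h2 using 2 with i
    rw [map_smul, HilbertBasis.repr_apply_apply, hSin]
    rfl

theorem IsNuclearRep.isTraceClass {ι : Type*} {V : H →L[ℂ] H} {x y : ι → H}
    (h : IsNuclearRep V x y) : IsTraceClass V := by
  obtain ⟨W, hW, hVW⟩ := exists_factor (norm_abs_apply V)
  have hsum : Summable fun p : ι × basisSet H =>
      ‖inner ℂ (y p.1) (stdBasis H p.2)‖ * ‖inner ℂ (stdBasis H p.2) (W (x p.1))‖ := by
    refine summable_prod_of_sum_le (fun p => by positivity) h.summable (fun n s => ?_)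
    rw [mul_comm ‖x n‖]
    refine sum_mul_le (norm_nonneg _) (norm_nonneg _) (fun s => ?_) (fun s => ?_) s
    · exact (Finset.sum_congr rfl fun i _ => by rw [norm_inner_symm]).trans_le
        ((stdBasis H).orthonormal.sum_inner_products_le (y n))
    · refine ((stdBasis H).orthonormal.sum_inner_products_le (W (x n))).trans ?_
      exact pow_le_pow_left₀ (norm_nonneg _) (hW _) 2
  have h2 : Summable fun p : basisSet H × ι =>
      inner ℂ (y p.2) (stdBasis H p.1) * inner ℂ (stdBasis H p.1) (W (x p.2)) := by
    refine Summable.of_norm ?_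
    refine hsum.prod_symm.congr fun p => ?_
    rw [norm_mul]
    rfl
  have h3 : ∀ i, HasSum (fun n => inner ℂ (y n) (stdBasis H i) *
      inner ℂ (stdBasis H i) (W (x n)))
      (inner ℂ (stdBasis H i) (CFC.abs V (stdBasis H i))) := fun i => by
    have h4 := ((innerSL ℂ (stdBasis H i)) ∘L W).hasSum (h.hasSum (stdBasis H i))
    rw [ContinuousLinearMap.comp_apply, ← hVW] at h4
    refine HasSum.congr_fun h4 (fun n => ?_)
    rw [map_smul]
    rfl
  have h6 := h2.prod
  have h7 : Summable fun i => inner ℂ (stdBasis H i) (CFC.abs V (stdBasis H i)) := by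
    exact h6.congr fun i => (h3 i).tsum_eq
  exact Complex.reCLM.summable h7

end TraceClass

section TraceClassSpace

variable {H K E F : Type*} [NormedAddCommGroup H] [InnerProductSpace ℂ H] [CompleteSpace H]
  [NormedAddCommGroup K] [InnerProductSpace ℂ K] [CompleteSpace K]
  [NormedAddCommGroup E] [InnerProductSpace ℂ E] [CompleteSpace E]
  [NormedAddCommGroup F] [InnerProductSpace ℂ F] [CompleteSpace F]

theorem IsNuclearRep.add {ι κ : Type*} {V V' : H →L[ℂ] H} {x y : ι → H} {x' y' : κ → H}
    (h : IsNuclearRep V x y) (h' : IsNuclearRep V' x' y') :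
    IsNuclearRep (V + V') (Sum.elim x x') (Sum.elim y y') where
  summable := Summable.sum _ h.summable h'.summable
  hasSum v := HasSum.sum (h.hasSum v) (h'.hasSum v)

theorem IsNuclearRep.conj {ι : Type*} {V : H →L[ℂ] H} {x y : ι → H} (h : IsNuclearRep V x y)
    (A B : H →L[ℂ] K) :
    IsNuclearRep (A ∘L V ∘L ContinuousLinearMap.adjoint B) (fun n => A (x n)) (fun n => B (y n)) where
  summable := by
    refine Summable.of_nonneg_of_le (fun n => by positivity) (fun n => ?_)
      (h.summable.mul_left (‖A‖ * ‖B‖))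
    rw [mul_mul_mul_comm]
    exact mul_le_mul (A.le_opNorm _) (B.le_opNorm _) (norm_nonneg _) (by positivity)
  hasSum v := by
    refine HasSum.congr_fun (A.hasSum (h.hasSum (ContinuousLinearMap.adjoint B v))) (fun n => ?_)
    rw [map_smul, ContinuousLinearMap.adjoint_inner_right]

/-- The space of trace class operators on `H`. -/
def traceClass (H : Type*) [NormedAddCommGroup H] [InnerProductSpace ℂ H] [CompleteSpace H] :
    Submodule ℂ (H →L[ℂ] H) where
  carrier := {V | IsTraceClass V}
  add_mem' := by
    intro V V' hV hV'
    obtain ⟨x, y, h⟩ := IsTraceClass.exists_rep hV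
    obtain ⟨x', y', h'⟩ := IsTraceClass.exists_rep hV'
    exact (h.add h').isTraceClass
  zero_mem' := by
    refine IsNuclearRep.isTraceClass (ι := Empty) (x := fun _ => 0) (y := fun _ => 0) ⟨?_, ?_⟩
    · exact summable_empty
    · intro v
      exact hasSum_empty
  smul_mem' := by
    intro c V hV
    obtain ⟨x, y, h⟩ := IsTraceClass.exists_rep hV
    refine IsNuclearRep.isTraceClass (x := fun n => c • x n) (y := y) ⟨?_, fun v => ?_⟩
    · refine (h.summable.mul_left ‖c‖).congr fun n => ?_
      rw [norm_smul, mul_assoc]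
    · refine HasSum.congr_fun ((h.hasSum v).const_smul c) (fun n => ?_)
      rw [smul_comm]

/-- The trace `∑ i, ⟪i, ρ i⟫` of a trace class operator. -/
def trace (ρ : traceClass H) : ℂ :=
  ∑' i, inner ℂ (stdBasis H i) (ρ.1 (stdBasis H i))

/-- The rank one operator `|x⟩⟨y|`. -/
def ketbra (x y : H) : traceClass H :=
  ⟨InnerProductSpace.rankOne ℂ x y, by
    refine IsNuclearRep.isTraceClass (ι := Unit) (x := fun _ => x) (y := fun _ => y) ⟨?_, ?_⟩
    · exact (hasSum_fintype _).summable
    · intro v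
      convert hasSum_fintype (fun _ : Unit => inner ℂ y v • x)
      simp⟩

/-- The linear map `ρ ↦ U ρ U⋆` on trace class operators. -/
def conjBy (U : H →L[ℂ] K) : traceClass H →ₗ[ℂ] traceClass K where
  toFun ρ := ⟨U ∘L ρ.1 ∘L ContinuousLinearMap.adjoint U, by
    obtain ⟨x, y, h⟩ := IsTraceClass.exists_rep ρ.2
    exact (h.conj U U).isTraceClass⟩
  map_add' ρ σ := by
    ext v
    simp
  map_smul' c ρ := by
    ext v
    simp

/-- The operator `x ↦ x ⊗ d`, that is, `I ⊗ |d⟩`. -/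
def inclRight (E : Type*) {F : Type*} [NormedAddCommGroup E] [InnerProductSpace ℂ E]
    [NormedAddCommGroup F] [InnerProductSpace ℂ F] (d : F) : E →L[ℂ] HTensor E F :=
  (htmulL E F).flip d

theorem inclRight_apply (d : F) (x : E) : inclRight E d x = htmul x d := rfl

theorem adjoint_inclRight_inclRight (d d' : F) (x : E) :
    ContinuousLinearMap.adjoint (inclRight E d) (inclRight E d' x) = inner ℂ d d' • x := by
  refine ext_inner_left ℂ fun v => ?_
  rw [ContinuousLinearMap.adjoint_inner_right, inclRight_apply, inclRight_apply, inner_htmul,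
    inner_smul_right, mul_comm]

theorem sum_norm_slice_sq_le {κ : Type*} {d : κ → F} (hd : Orthonormal ℂ d) (x : HTensor E F)
    (s : Finset κ) :
    ∑ j ∈ s, ‖ContinuousLinearMap.adjoint (inclRight E (d j)) x‖ ^ 2 ≤ ‖x‖ ^ 2 := by
  classical
  set z : HTensor E F :=
    ∑ j ∈ s, inclRight E (d j) (ContinuousLinearMap.adjoint (inclRight E (d j)) x) with hz
  have h1 : inner ℂ z x =
      ((∑ j ∈ s, ‖ContinuousLinearMap.adjoint (inclRight E (d j)) x‖ ^ 2 : ℝ) : ℂ) := by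
    rw [hz, sum_inner]
    push_cast
    refine Finset.sum_congr rfl fun j _ => ?_
    rw [← ContinuousLinearMap.adjoint_inner_right, inner_self_eq_norm_sq_to_K]
    rfl
  have h2 : inner ℂ z z =
      ((∑ j ∈ s, ‖ContinuousLinearMap.adjoint (inclRight E (d j)) x‖ ^ 2 : ℝ) : ℂ) := by
    conv_lhs => rw [hz, sum_inner]
    push_cast
    refine Finset.sum_congr rfl fun j hj => ?_
    rw [← ContinuousLinearMap.adjoint_inner_right, map_sum]
    simp_rw [adjoint_inclRight_inclRight, orthonormal_iff_ite.1 hd]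
    simp only [ite_smul, one_smul, zero_smul, Finset.sum_ite_eq, hj, if_true]
    rw [inner_self_eq_norm_sq_to_K]
    rfl
  set S := ∑ j ∈ s, ‖ContinuousLinearMap.adjoint (inclRight E (d j)) x‖ ^ 2 with hS
  have h3 : ‖z‖ ^ 2 = S := by
    have := inner_self_eq_norm_sq_to_K (𝕜 := ℂ) z
    rw [h2] at this
    exact Complex.ofReal_injective (by push_cast; exact this.symm)
  have h4 : S ≤ ‖z‖ * ‖x‖ := by
    have := norm_inner_le_norm (𝕜 := ℂ) z x
    rw [h1, Complex.norm_real] at this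
    exact (le_abs_self _).trans this
  nlinarith [sq_nonneg (‖z‖ - ‖x‖)]

/-- The partial trace of `ρ` over the second factor as a bounded operator,
`∑ j, (I ⊗ ⟨j|) ρ (I ⊗ |j⟩)`; the series converges in operator norm for trace class `ρ`. -/
def ptraceOp (ρ : HTensor E F →L[ℂ] HTensor E F) : E →L[ℂ] E :=
  ∑' j, ContinuousLinearMap.adjoint (inclRight E (stdBasis F j)) ∘L ρ ∘L
    inclRight E (stdBasis F j)

theorem IsNuclearRep.slices {ι : Type*} {V : HTensor E F →L[ℂ] HTensor E F}
    {x y : ι → HTensor E F} (h : IsNuclearRep V x y) :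
    Summable fun p : basisSet F × ι =>
      ‖ContinuousLinearMap.adjoint (inclRight E (stdBasis F p.1)) (x p.2)‖ *
        ‖ContinuousLinearMap.adjoint (inclRight E (stdBasis F p.1)) (y p.2)‖ := by
  have h1 : Summable fun p : ι × basisSet F =>
      ‖ContinuousLinearMap.adjoint (inclRight E (stdBasis F p.2)) (x p.1)‖ *
        ‖ContinuousLinearMap.adjoint (inclRight E (stdBasis F p.2)) (y p.1)‖ :=
    summable_prod_of_sum_le (fun p => by positivity) h.summable fun n s =>
      sum_mul_le (norm_nonneg _) (norm_nonneg _)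
        (sum_norm_slice_sq_le (stdBasis F).orthonormal (x n))
        (sum_norm_slice_sq_le (stdBasis F).orthonormal (y n)) s
  exact h1.prod_symm

theorem IsNuclearRep.norm_le {ι : Type*} {V : H →L[ℂ] H} {x y : ι → H}
    (h : IsNuclearRep V x y) : ‖V‖ ≤ ∑' n, ‖x n‖ * ‖y n‖ := by
  refine V.opNorm_le_bound (tsum_nonneg fun n => by positivity) fun v => ?_
  rw [← (h.hasSum v).tsum_eq, ← tsum_mul_right]
  refine tsum_of_norm_bounded (h.summable.mul_right ‖v‖).hasSum fun n => ?_
  rw [norm_smul]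
  calc ‖inner ℂ (y n) v‖ * ‖x n‖ ≤ (‖y n‖ * ‖v‖) * ‖x n‖ :=
        mul_le_mul_of_nonneg_right (norm_inner_le_norm _ _) (norm_nonneg _)
    _ = _ := by ring

theorem summable_ptrace {V : HTensor E F →L[ℂ] HTensor E F} (hV : IsTraceClass V) :
    Summable fun j => ContinuousLinearMap.adjoint (inclRight E (stdBasis F j)) ∘L V ∘L
      inclRight E (stdBasis F j) := by
  obtain ⟨x, y, h⟩ := hV.exists_rep
  refine Summable.of_norm_bounded h.slices.prod fun j => ?_
  have := (h.conj (ContinuousLinearMap.adjoint (inclRight E (stdBasis F j)))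
    (ContinuousLinearMap.adjoint (inclRight E (stdBasis F j)))).norm_le
  rwa [ContinuousLinearMap.adjoint_adjoint] at this

theorem IsNuclearRep.of_hasSum {ι κ : Type*} {V : K →L[ℂ] K} {x y : ι → K}
    (h : IsNuclearRep V x y) {A : κ → K →L[ℂ] H} {W : H →L[ℂ] H}
    (hA : Summable fun p : κ × ι => ‖A p.1 (x p.2)‖ * ‖A p.1 (y p.2)‖)
    (hW : HasSum (fun j => A j ∘L V ∘L ContinuousLinearMap.adjoint (A j)) W) :
    IsNuclearRep W (fun p : κ × ι => A p.1 (x p.2)) (fun p : κ × ι => A p.1 (y p.2)) where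
  summable := hA
  hasSum v := by
    have hs : Summable fun p : κ × ι => inner ℂ (A p.1 (y p.2)) v • A p.1 (x p.2) := by
      refine Summable.of_norm_bounded (hA.mul_right ‖v‖) fun p => ?_
      rw [norm_smul]
      refine (mul_le_mul_of_nonneg_right (norm_inner_le_norm _ _) (norm_nonneg _)).trans_eq ?_
      ring
    have h2 := hs.hasSum.prod_fiberwise fun j => (h.conj (A j) (A j)).hasSum v
    have h3 := (ContinuousLinearMap.apply ℂ H v).hasSum hW
    rw [ContinuousLinearMap.apply_apply] at h3
    rw [← h2.unique h3]
    exact hs.hasSum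

theorem isTraceClass_ptraceOp {V : HTensor E F →L[ℂ] HTensor E F} (hV : IsTraceClass V) :
    IsTraceClass (ptraceOp V) := by
  obtain ⟨x, y, h⟩ := hV.exists_rep
  refine (h.of_hasSum
    (A := fun j => ContinuousLinearMap.adjoint (inclRight E (stdBasis F j))) h.slices ?_).isTraceClass
  simp_rw [ContinuousLinearMap.adjoint_adjoint]
  exact (summable_ptrace hV).hasSum

/-- The partial trace over the second factor. -/
def ptrace (E F : Type*) [NormedAddCommGroup E] [InnerProductSpace ℂ E] [CompleteSpace E]
    [NormedAddCommGroup F] [InnerProductSpace ℂ F] [CompleteSpace F] :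
    traceClass (HTensor E F) →ₗ[ℂ] traceClass E where
  toFun ρ := ⟨ptraceOp ρ.1, isTraceClass_ptraceOp ρ.2⟩
  map_add' ρ σ := by
    refine Subtype.ext ?_
    change ptraceOp (ρ.1 + σ.1) = ptraceOp ρ.1 + ptraceOp σ.1
    rw [ptraceOp, ptraceOp, ptraceOp,
      ← (summable_ptrace ρ.2).tsum_add (summable_ptrace σ.2)]
    refine tsum_congr fun j => ?_
    rw [ContinuousLinearMap.add_comp, ContinuousLinearMap.comp_add]
  map_smul' c ρ := by
    refine Subtype.ext ?_
    change ptraceOp (c • ρ.1) = c • ptraceOp ρ.1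
    rw [ptraceOp, ptraceOp, ← (summable_ptrace ρ.2).tsum_const_smul c]
    refine tsum_congr fun j => ?_
    rw [ContinuousLinearMap.smul_comp, ContinuousLinearMap.comp_smul]

end TraceClassSpace

/-! ### Quantum channels and their representations -/

section Channels

variable {H K R : Type*} [NormedAddCommGroup H] [InnerProductSpace ℂ H] [CompleteSpace H]
  [NormedAddCommGroup K] [InnerProductSpace ℂ K] [CompleteSpace K]
  [NormedAddCommGroup R] [InnerProductSpace ℂ R] [CompleteSpace R]

/-- A block operator `(ρ i j)` on `H ⊗ ℂⁿ` is positive: `∑ i j, ⟪x i, ρ i j (x j)⟫ ≥ 0`. -/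
def IsPositiveBlock {n : ℕ} (ρ : Fin n → Fin n → traceClass H) : Prop :=
  ∀ x : Fin n → H, 0 ≤ ∑ i, ∑ j, inner ℂ (x i) ((ρ i j).1 (x j))

/-- Complete positivity: every amplification `Φ ⊗ id` to `n × n` block operators is positive. -/
def IsCompletelyPositive (Φ : traceClass H →ₗ[ℂ] traceClass K) : Prop :=
  ∀ (n : ℕ) (ρ : Fin n → Fin n → traceClass H), IsPositiveBlock ρ →
    IsPositiveBlock fun i j => Φ (ρ i j)

/-- Completely positive, trace-preserving maps. -/
structure IsCPTP (Φ : traceClass H →ₗ[ℂ] traceClass K) : Prop where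
  completelyPositive : IsCompletelyPositive Φ
  trace_preserving : ∀ ρ, trace (Φ ρ) = trace ρ

/-- The complex conjugate `∑ i, conj ⟪i, h⟫ • |i⟩` of a vector with respect to a basis. -/
def conjVec {ι : Type*} (a : HilbertBasis ι ℂ H) (h : H) : H :=
  a.repr.symm (star (a.repr h))

theorem conjVec_add {ι : Type*} (a : HilbertBasis ι ℂ H) (h h' : H) :
    conjVec a (h + h') = conjVec a h + conjVec a h' := by
  simp [conjVec]

theorem conjVec_smul {ι : Type*} (a : HilbertBasis ι ℂ H) (c : ℂ) (h : H) :
    conjVec a (c • h) = star c • conjVec a h := by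
  simp [conjVec]

theorem ketbra_apply (x y v : H) : (ketbra x y).1 v = inner ℂ y v • x := rfl

theorem ketbra_add_left (x x' y : H) : ketbra (x + x') y = ketbra x y + ketbra x' y :=
  Subtype.ext (by simp [ketbra])

theorem ketbra_add_right (x y y' : H) : ketbra x (y + y') = ketbra x y + ketbra x y' :=
  Subtype.ext (by simp [ketbra])

theorem ketbra_smul_left (c : ℂ) (x y : H) : ketbra (c • x) y = c • ketbra x y :=
  Subtype.ext (by simp [ketbra])

theorem ketbra_smul_right (c : ℂ) (x y : H) : ketbra x (c • y) = star c • ketbra x y :=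
  Subtype.ext (by simp [ketbra])

/-- The linear form `k' ⊗ h' ↦ ⟨k| Φ(|conj h⟩⟨conj h'|) |k'⟩`. -/
def choiRight {ι : Type*} (a : HilbertBasis ι ℂ H) (Φ : traceClass H →ₗ[ℂ] traceClass K)
    (k : K) (h : H) : K ⊗[ℂ] H →ₗ[ℂ] ℂ :=
  TensorProduct.lift <| LinearMap.mk₂ ℂ
    (fun k' h' => inner ℂ k ((Φ (ketbra (conjVec a h) (conjVec a h'))).1 k'))
    (fun k₁ k₂ h' => by simp)
    (fun c k' h' => by simp)
    (fun k' h₁ h₂ => by simp [conjVec_add, ketbra_add_right])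
    (fun c k' h' => by simp [conjVec_smul, ketbra_smul_right])

/-- The Choi–Jamiołkowski representation of `Φ`: the sesquilinear form on the algebraic span of the
simple tensors, antilinear in the first and linear in the second argument, with
`R(k ⊗ h ; k' ⊗ h') = ⟨k| Φ(|conj h⟩⟨conj h'|) |k'⟩`, where vectors of `H` are conjugated with
respect to the basis `a`. -/
def choi {ι : Type*} (a : HilbertBasis ι ℂ H) (Φ : traceClass H →ₗ[ℂ] traceClass K) :
    K ⊗[ℂ] H →ₗ⋆[ℂ] K ⊗[ℂ] H →ₗ[ℂ] ℂ :=
  TensorProduct.lift <| LinearMap.mk₂'ₛₗ (starRingEnd ℂ) (starRingEnd ℂ)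
    (fun k h => choiRight a Φ k h)
    (fun k₁ k₂ h => by ext; simp [choiRight])
    (fun c k h => by ext; simp [choiRight, mul_comm])
    (fun k h₁ h₂ => by ext; simp [choiRight, conjVec_add, ketbra_add_left])
    (fun c k h => by ext; simp [choiRight, conjVec_smul, ketbra_smul_left])

theorem choi_tmul {ι : Type*} (a : HilbertBasis ι ℂ H) (Φ : traceClass H →ₗ[ℂ] traceClass K)
    (k k' : K) (h h' : H) : choi a Φ (k ⊗ₜ h) (k' ⊗ₜ h') =
      inner ℂ k ((Φ (ketbra (conjVec a h) (conjVec a h'))).1 k') := rfl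

/-- `U` is a Stinespring representation of `Φ` with ancilla `R`: `Φ(ρ) = tr_R (U ρ U⋆)`. -/
def IsStinespring (Φ : traceClass H →ₗ[ℂ] traceClass K) (U : H →L[ℂ] HTensor K R) : Prop :=
  ∀ ρ, Φ ρ = ptrace K R (conjBy U ρ)

/-- A Stinespring representation `U : H → K ⊗ R` of `Φ` is minimal if the vectors `(X ⊗ I_R) U h`,
for `X` a bounded operator on `K` and `h` in `H`, span a dense subspace of `K ⊗ R`. -/
structure IsMinimalStinespring (Φ : traceClass H →ₗ[ℂ] traceClass K) (U : H →L[ℂ] HTensor K R) :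
    Prop where
  isStinespring : IsStinespring Φ U
  minimal : (Submodule.span ℂ {z : HTensor K R | ∃ (X : K →L[ℂ] K) (h : H),
    z = hmap X (ContinuousLinearMap.id ℂ R) (U h)}).topologicalClosure = ⊤

/-- The composite `(I_C ⊗ V) (U ⊗ I_B)` of `U : A → C ⊗ Q` and `V : Q ⊗ B → D ⊗ R`. -/
def sequential {A B C D Q R : Type*} [NormedAddCommGroup A] [InnerProductSpace ℂ A]
    [NormedAddCommGroup B] [InnerProductSpace ℂ B] [NormedAddCommGroup C] [InnerProductSpace ℂ C]
    [NormedAddCommGroup D] [InnerProductSpace ℂ D] [NormedAddCommGroup Q] [InnerProductSpace ℂ Q]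
    [NormedAddCommGroup R] [InnerProductSpace ℂ R]
    (U : A →L[ℂ] HTensor C Q) (V : HTensor Q B →L[ℂ] HTensor D R) :
    HTensor A B →L[ℂ] HTensor (HTensor C D) R :=
  (hassoc C D R).symm.toContinuousLinearEquiv.toContinuousLinearMap ∘L
    hmap (ContinuousLinearMap.id ℂ C) V ∘L
    (hassoc C Q B).toContinuousLinearEquiv.toContinuousLinearMap ∘L
    hmap U (ContinuousLinearMap.id ℂ B)

end Channels

/-! ### Fock space -/

section FockSpace

/-- The bosonic Fock space `⊕ₙ ∨ⁿ ℓ²(S)`. Here `ℓ²(List S) = ⊕ₙ ℓ²(Sⁿ) = ⊕ₙ ℓ²(S)^{⊗ n}`, and the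
symmetric subspaces consist of the functions that are invariant under permuting the entries. -/
def Fock (S : Type*) : Submodule ℂ (lp (fun _ : List S => ℂ) 2) where
  carrier := {f | ∀ l l' : List S, l.Perm l' → f l = f l'}
  add_mem' := by
    intro f g hf hg l l' h
    simp [hf l l' h, hg l l' h]
  zero_mem' := by
    intro l l' _
    simp
  smul_mem' := by
    intro c f hf l l' h
    simp [hf l l' h]

theorem isClosed_Fock (S : Type*) : IsClosed (Fock S : Set (lp (fun _ : List S => ℂ) 2)) := by
  have h : (Fock S : Set (lp (fun _ : List S => ℂ) 2)) =
      ⋂ (l : List S) (l' : List S) (_ : l.Perm l'), {f | f l = f l'} := by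
    ext f
    simp only [Set.mem_iInter, Set.mem_ofPred_eq]
    rfl
  rw [h]
  refine isClosed_iInter fun l => isClosed_iInter fun l' => isClosed_iInter fun _ => ?_
  have hc : ∀ l : List S, Continuous fun f : lp (fun _ : List S => ℂ) 2 => f l := fun l =>
    (lp.evalCLM ℂ (fun _ : List S => ℂ) 2 l).continuous
  exact isClosed_eq (hc l) (hc l')

instance (S : Type*) : CompleteSpace (Fock S) :=
  (isClosed_Fock S).completeSpace_coe

/-- The orderings of a multiset. -/
def orderings {S : Type*} (m : Multiset S) : Set (List S) := {l | (l : Multiset S) = m}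

theorem finite_orderings {S : Type*} (m : Multiset S) : (orderings m).Finite := by
  induction m using Quotient.inductionOn with
  | h l =>
    refine (List.finite_toSet l.permutations).subset fun l' hl' => ?_
    exact List.mem_permutations.2 (Multiset.coe_eq_coe.1 hl')

theorem orderings_ncard_pos {S : Type*} (m : Multiset S) : 0 < (orderings m).ncard := by
  rw [Set.ncard_pos (finite_orderings m)]
  induction m using Quotient.inductionOn with
  | h l => exact ⟨l, rfl⟩

open Classical in
/-- The normalized symmetric state of a multiset of basis states: the sum of `|l⟩` over all
orderings `l` of `m`, divided by the square root of their number. -/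
def fockVec {S : Type*} (m : Multiset S) : Fock S :=
  ⟨⟨fun l => if l ∈ orderings m then ((√(orderings m).ncard : ℝ) : ℂ)⁻¹ else 0, by
    refine memℓp_gen ?_
    refine summable_of_hasFiniteSupport ((finite_orderings m).subset fun l hl => ?_)
    by_contra hn
    simp [hn] at hl⟩, by
    intro l l' h
    have : l ∈ orderings m ↔ l' ∈ orderings m := by
      simp only [orderings, Set.mem_ofPred_eq, Multiset.coe_eq_coe.2 h]
    change (if l ∈ orderings m then _ else _) = (if l' ∈ orderings m then _ else _)
    simp only [this]⟩

theorem inner_fockVec {S : Type*} (m : Multiset S) (f : Fock S) (l : List S)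
    (hl : l ∈ orderings m) :
    inner ℂ (fockVec m) f = ((√(orderings m).ncard : ℝ) : ℂ) * (f : lp (fun _ : List S => ℂ) 2) l := by
  classical
  have h1 : inner ℂ (fockVec m) f = ∑' l', inner ℂ
      ((fockVec m : lp (fun _ : List S => ℂ) 2) l') ((f : lp (fun _ : List S => ℂ) 2) l') :=
    lp.inner_eq_tsum _ _
  have h2 : ∀ l' ∉ (finite_orderings m).toFinset, inner ℂ
      ((fockVec m : lp (fun _ : List S => ℂ) 2) l') ((f : lp (fun _ : List S => ℂ) 2) l') = 0 := by
    intro l' hl'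
    rw [Set.Finite.mem_toFinset] at hl'
    have : (fockVec m : lp (fun _ : List S => ℂ) 2) l' = 0 := if_neg hl'
    rw [this, inner_zero_left]
  have h3 : ∀ l' ∈ (finite_orderings m).toFinset, inner ℂ
      ((fockVec m : lp (fun _ : List S => ℂ) 2) l') ((f : lp (fun _ : List S => ℂ) 2) l') =
      ((√(orderings m).ncard : ℝ) : ℂ)⁻¹ * (f : lp (fun _ : List S => ℂ) 2) l := by
    intro l' hl'
    rw [Set.Finite.mem_toFinset] at hl'
    have h4 : (fockVec m : lp (fun _ : List S => ℂ) 2) l' = ((√(orderings m).ncard : ℝ) : ℂ)⁻¹ :=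
      if_pos hl'
    have h5 : (f : lp (fun _ : List S => ℂ) 2) l' = (f : lp (fun _ : List S => ℂ) 2) l :=
      f.2 l' l (Multiset.coe_eq_coe.1 (hl'.trans hl.symm))
    rw [h4, h5, ← Complex.ofReal_inv]
    simp [mul_comm]
  rw [h1, tsum_eq_sum h2, Finset.sum_congr rfl h3, Finset.sum_const,
    ← Set.ncard_eq_toFinset_card _ (finite_orderings m), nsmul_eq_mul, ← mul_assoc]
  congr 1
  have h6 : (0 : ℝ) < (orderings m).ncard := by exact_mod_cast orderings_ncard_pos m
  have h7 : (√(orderings m).ncard : ℝ) ≠ 0 := (Real.sqrt_pos.2 h6).ne'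
  have h8 : ((orderings m).ncard : ℝ) * (√(orderings m).ncard : ℝ)⁻¹ = √(orderings m).ncard := by
    rw [← div_eq_mul_inv, Real.div_sqrt]
  exact_mod_cast h8

theorem exists_mem_orderings {S : Type*} (m : Multiset S) : ∃ l, l ∈ orderings m :=
  (Set.ncard_pos (finite_orderings m)).1 (orderings_ncard_pos m)

/-- The orthonormal basis of the Fock space indexed by multisets. -/
def fockBasis (S : Type*) : HilbertBasis (Multiset S) ℂ (Fock S) :=
  HilbertBasis.mkOfOrthogonalEqBot (v := fockVec)
    (by
      classical
      rw [orthonormal_iff_ite]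
      intro m m'
      obtain ⟨l, hl⟩ := exists_mem_orderings m
      rw [inner_fockVec m _ l hl]
      have h6 : (0 : ℝ) < (orderings m).ncard := by exact_mod_cast orderings_ncard_pos m
      have h7 : ((√(orderings m).ncard : ℝ) : ℂ) ≠ 0 :=
        Complex.ofReal_ne_zero.2 (Real.sqrt_pos.2 h6).ne'
      split_ifs with h
      · subst h
        have : (fockVec m : lp (fun _ : List S => ℂ) 2) l = ((√(orderings m).ncard : ℝ) : ℂ)⁻¹ :=
          if_pos hl
        rw [this, mul_inv_cancel₀ h7]
      · have : (fockVec m' : lp (fun _ : List S => ℂ) 2) l = 0 :=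
          if_neg fun hl' => h (hl.symm.trans hl')
        rw [this, mul_zero])
    (by
      rw [Submodule.eq_bot_iff]
      intro f hf
      refine Subtype.ext (lp.ext (funext fun l => ?_))
      have h0 : inner ℂ (fockVec (l : Multiset S)) f = 0 :=
        (Submodule.mem_orthogonal _ _).1 hf _ (Submodule.subset_span ⟨_, rfl⟩)
      rw [inner_fockVec (l : Multiset S) f l rfl] at h0
      have h6 : (0 : ℝ) < (orderings (l : Multiset S)).ncard := by
        exact_mod_cast orderings_ncard_pos (l : Multiset S)
      exact (mul_eq_zero.1 h0).resolve_left
        (Complex.ofReal_ne_zero.2 (Real.sqrt_pos.2 h6).ne'))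

theorem fockBasis_apply {S : Type*} (m : Multiset S) : fockBasis S m = fockVec m := by
  rw [fockBasis, HilbertBasis.coe_mkOfOrthogonalEqBot]

theorem filterMap_none {S S' : Type*} (m : Multiset S) :
    m.filterMap (fun _ => (none : Option S')) = 0 := by
  induction m using Multiset.induction_on with
  | empty => simp
  | cons s m ih => rw [Multiset.filterMap_cons_none _ _ rfl, ih]

/-- If `e` splits the basis states of `S` into two classes, then multisets on `S` correspond to
pairs of multisets on the two classes. -/
def multisetSplit {S₁ S₂ S : Type*} (e : S₁ ⊕ S₂ ≃ S) : Multiset S₁ × Multiset S₂ ≃ Multiset S :=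
  Equiv.ofBijective (fun p => p.1.map (fun s => e (Sum.inl s)) + p.2.map (fun s => e (Sum.inr s)))
    (by
      constructor
      · rintro ⟨m₁, m₂⟩ ⟨m₁', m₂'⟩ h
        have hL : ∀ (m₁ : Multiset S₁) (m₂ : Multiset S₂),
            (m₁.map (fun s => e (Sum.inl s)) + m₂.map (fun s => e (Sum.inr s))).filterMap
              (fun s => (e.symm s).getLeft?) = m₁ := by
          intro m₁ m₂
          rw [Multiset.filterMap_add, Multiset.filterMap_map, Multiset.filterMap_map]
          simp [Function.comp_def, Multiset.filterMap_some, filterMap_none]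
        have hR : ∀ (m₁ : Multiset S₁) (m₂ : Multiset S₂),
            (m₁.map (fun s => e (Sum.inl s)) + m₂.map (fun s => e (Sum.inr s))).filterMap
              (fun s => (e.symm s).getRight?) = m₂ := by
          intro m₁ m₂
          rw [Multiset.filterMap_add, Multiset.filterMap_map, Multiset.filterMap_map]
          simp [Function.comp_def, Multiset.filterMap_some, filterMap_none]
        have h : m₁.map (fun s => e (Sum.inl s)) + m₂.map (fun s => e (Sum.inr s)) =
          m₁'.map (fun s => e (Sum.inl s)) + m₂'.map (fun s => e (Sum.inr s)) := h
        refine Prod.ext ?_ ?_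
        · rw [← hL m₁ m₂, h, hL]
        · rw [← hR m₁ m₂, h, hR]
      · intro m
        induction m using Multiset.induction_on with
        | empty => exact ⟨(0, 0), by simp⟩
        | cons s m ih =>
          obtain ⟨⟨m₁, m₂⟩, rfl⟩ := ih
          obtain ⟨t, rfl⟩ := e.surjective s
          rcases t with t | t
          · exact ⟨(t ::ₘ m₁, m₂), by simp⟩
          · exact ⟨(m₁, t ::ₘ m₂), by simp⟩)

/-- The unitary `Fock(ℓ²(S₁)) ⊗ Fock(ℓ²(S₂)) ≃ Fock(ℓ²(S₁) ⊕ ℓ²(S₂))` that sends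
`|m₁⟩ ⊗ |m₂⟩` to `|m₁ + m₂⟩` for multisets `m₁`, `m₂` of basis states. -/
def fockSplit {S₁ S₂ S : Type*} (e : S₁ ⊕ S₂ ≃ S) :
    HTensor (Fock S₁) (Fock S₂) ≃ₗᵢ[ℂ] Fock S :=
  (tensorBasis (fockBasis S₁) (fockBasis S₂)).repr.trans
    (HilbertBasis.mk (v := fun p => fockBasis S (multisetSplit e p))
      ((fockBasis S).orthonormal.comp _ (multisetSplit e).injective)
      (by
        have := (fockBasis S).dense_span
        rw [← (multisetSplit e).surjective.range_comp (fockBasis S)] at this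
        exact this.ge)).repr.symm

theorem fockSplit_htmul {S₁ S₂ S : Type*} (e : S₁ ⊕ S₂ ≃ S) (m₁ : Multiset S₁)
    (m₂ : Multiset S₂) : fockSplit e (htmul (fockVec m₁) (fockVec m₂)) =
      fockVec (m₁.map (fun s => e (Sum.inl s)) + m₂.map (fun s => e (Sum.inr s))) := by
  classical
  rw [← fockBasis_apply, ← fockBasis_apply, ← fockBasis_apply,
    ← tensorBasis_apply (fockBasis S₁) (fockBasis S₂) (m₁, m₂), fockSplit,
    LinearIsometryEquiv.trans_apply, HilbertBasis.repr_self, HilbertBasis.repr_symm_single,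
    HilbertBasis.coe_mk]
  rfl

end FockSpace

/-! ### Wires, cuts and causality functions -/

section Cuts

variable {T : Type*}

/-- The state space of a wire carrying `d`-dimensional messages in positions `P`: the Fock space
over `ℓ²(P) ⊗ ℂᵈ`, the latter with orthonormal basis `P × {1, …, d}`. -/
abbrev Wire (P : Set T) (d : ℕ) : Type _ := Fock (P × Fin d)

open Classical in
/-- Messages in positions `Q` are messages in positions `P` or in positions `Q \ P`. -/
def splitPositions {P Q : Set T} (h : P ⊆ Q) (d : ℕ) :
    (P × Fin d) ⊕ ((Q \ P : Set T) × Fin d) ≃ Q × Fin d :=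
  (Equiv.sumProdDistrib P (Q \ P : Set T) (Fin d)).symm.trans
    ((Equiv.Set.sumDiffSubset h).prodCongr (Equiv.refl _))

/-- The splitting of a wire: `Wire P ⊗ Wire (Q \ P) ≃ Wire Q`. -/
def wireSplit {P Q : Set T} (h : P ⊆ Q) (d : ℕ) :
    HTensor (Wire P d) (Wire (Q \ P : Set T) d) ≃ₗᵢ[ℂ] Wire Q d :=
  fockSplit (splitPositions h d)

/-- Tracing out the messages in positions `Q \ P`. -/
def traceOut {P Q : Set T} (h : P ⊆ Q) (d : ℕ) :
    traceClass (Wire Q d) →ₗ[ℂ] traceClass (Wire P d) :=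
  ptrace (Wire P d) (Wire (Q \ P : Set T) d) ∘ₗ
    conjBy (wireSplit h d).symm.toContinuousLinearEquiv.toContinuousLinearMap

/-- The composite `(I ⊗ V) (U ⊗ I)` as an operator on split wires. -/
def wireSequential {P P' S S' : Set T} (hX : P ⊆ P') (hY : S ⊆ S') {dX dY : ℕ}
    {Q R : Type*} [NormedAddCommGroup Q] [InnerProductSpace ℂ Q]
    [NormedAddCommGroup R] [InnerProductSpace ℂ R]
    (U : Wire P dX →L[ℂ] HTensor (Wire S dY) Q)
    (V : HTensor Q (Wire (P' \ P : Set T) dX) →L[ℂ] HTensor (Wire (S' \ S : Set T) dY) R) :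
    Wire P' dX →L[ℂ] HTensor (Wire S' dY) R :=
  hmap (wireSplit hY dY).toContinuousLinearEquiv.toContinuousLinearMap
      (ContinuousLinearMap.id ℂ R) ∘L
    sequential U V ∘L (wireSplit hX dX).symm.toContinuousLinearEquiv.toContinuousLinearMap

variable [PartialOrder T]

/-- A cut of `T`, i.e. a set that contains with `t` every `p ≤ t`, is bounded if it is contained
in `{p | p ≤ t}` for some point `t`. -/
def IsBoundedCut (C : LowerSet T) : Prop := ∃ t : T, (C : Set T) ⊆ Set.Iic t

/-- The bounded cuts of `T`. -/
abbrev BoundedCut (T : Type*) [PartialOrder T] : Type _ := {C : LowerSet T // IsBoundedCut C}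

/-- Causality functions on cuts. -/
structure IsCausalityFunction (χ : LowerSet T → LowerSet T) : Prop where
  map_union : ∀ C D, χ (C ⊔ D) = χ C ⊔ χ D
  monotone : ∀ C D, C ≤ D → χ C ≤ χ D
  decreasing : ∀ C, IsBoundedCut C → C ≠ ⊥ → χ C < C
  finite : ∀ C, IsBoundedCut C → ∀ t ∈ C, ∃ n : ℕ, t ∉ (χ^[n]) C

theorem IsCausalityFunction.coe_subset {χ : LowerSet T → LowerSet T}
    (hχ : IsCausalityFunction χ) {C D : LowerSet T} (h : C ≤ D) : (χ C : Set T) ⊆ χ D :=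
  LowerSet.coe_subset_coe.2 (hχ.monotone C D h)

end Cuts

end CausalBox

end

open CausalBox
universe u

/-! Everything is read off from the slices `slice R k (U h)`, that is, (⟨k| ⊗ I) U h. For a
Stinespring representation U of Φ, ⟨k| Φ(|h⟩⟨h'|) |k'⟩ is the inner product of the slice of U h' at
k' with the slice of U h at k (`IsStinespring.inner_ketbra`). So the values of a channel on rank one
operators are a Gram kernel, and two families with the same Gram kernel are related by an isometry
on the closed span of the first (`exists_linearIsometry_of_inner_eq`).

Tested on simple tensors, tr_D ∘ Φ = Ψ ∘ tr_B says that the C-slices of UΦ (e ⊗ f), which lie in D ⊗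
R, have the same Gram kernel as the vectors (C-slice of UΨ e) ⊗ f in Q ⊗ B. Minimality of UΨ makes
the latter total in Q ⊗ B when C ≠ 0 (`dense_slices_of_minimal`), so the isometry V exists on all of
Q ⊗ B. Comparing slices gives UΦ = (I ⊗ V)(UΨ ⊗ I) (`exists_sequential`). Conversely, an isometry
preserves the Gram kernel (`ptrace_comp_eq_of_sequential`). The Choi condition is the same family of
matrix elements after conjugating the input vectors, with the partial trace written as a sum over a
basis of D (`ptrace_comp_eq_iff_choi`).

The analytic point is that tests on simple tensors suffice, although channels are only assumed
linear on trace class operators. Positivity and trace preservation replace continuity: a trace class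
operator is a combination of four positive nuclear ones, and for a positive one the image of the
remainder of its series is controlled by the trace of the remainder (`IsCPTP.ext_ketbra`). A
dilation, built by a Kolmogorov decomposition (`exists_dilation`), shows that the matrix elements
depend continuously on the two vectors of a rank one operator, which reduces further to a set with
dense span (`IsCPTP.ext_of_dense`). The dilation also provides the minimal representations whose
existence (2') requires.

The corollary is the lemma carried along the unitaries `wireSplit`, which match number bases and
hence commute with conjugation. -/

noncomputable section

namespace CausalBox

/-! ### Slices of tensors -/

section Slices

variable {E F G H : Type*}
  [NormedAddCommGroup E] [InnerProductSpace ℂ E] [CompleteSpace E]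
  [NormedAddCommGroup F] [InnerProductSpace ℂ F] [CompleteSpace F]
  [NormedAddCommGroup G] [InnerProductSpace ℂ G] [CompleteSpace G]
  [NormedAddCommGroup H] [InnerProductSpace ℂ H] [CompleteSpace H]

/-- The slice map `⟨c| ⊗ I : E ⊗ F → F`. -/
def slice (F : Type*) [NormedAddCommGroup F] [InnerProductSpace ℂ F] [CompleteSpace F] (c : E) :
    HTensor E F →L[ℂ] F :=
  ContinuousLinearMap.adjoint (htmulL E F c)

theorem inner_slice_right (c : E) (x : F) (z : HTensor E F) :
    inner ℂ x (slice F c z) = inner ℂ (htmul c x) z :=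
  ContinuousLinearMap.adjoint_inner_right _ _ _

theorem inner_slice_left (c : E) (x : F) (z : HTensor E F) :
    inner ℂ (slice F c z) x = inner ℂ z (htmul c x) :=
  ContinuousLinearMap.adjoint_inner_left _ _ _

theorem slice_htmul (c e : E) (f : F) : slice F c (htmul e f) = inner ℂ c e • f := by
  refine ext_inner_left ℂ fun x => ?_
  rw [inner_slice_right, inner_htmul, inner_smul_right]

theorem ext_htmul {f g : HTensor E F →L[ℂ] G} (h : ∀ x y, f (htmul x y) = g (htmul x y)) :
    f = g := by
  refine ContinuousLinearMap.ext_on (dense_span_range_htmul (E := E) (F := F)) ?_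
  rintro _ ⟨x, -, y, -, rfl⟩
  exact h x y

/-- Slices determine inner products with simple tensors, and these span densely. Identities in
`HTensor E F` are therefore checked slice by slice. -/
theorem ext_slice {z w : HTensor E F} (h : ∀ c : E, slice F c z = slice F c w) : z = w := by
  have h1 : innerSL ℂ z = innerSL ℂ w := ext_htmul fun x y => by
    rw [innerSL_apply_apply, innerSL_apply_apply, ← inner_slice_left, ← inner_slice_left, h]
  refine ext_inner_right ℂ fun v => ?_
  exact DFunLike.congr_fun h1 v

theorem slice_hmap (f : E →L[ℂ] G) (g : F →L[ℂ] H) (c : G) (z : HTensor E F) :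
    slice H c (hmap f g z) = g (slice F (ContinuousLinearMap.adjoint f c) z) := by
  refine DFunLike.congr_fun (f := slice H c ∘L hmap f g)
    (g := g ∘L slice F (ContinuousLinearMap.adjoint f c)) (ext_htmul fun x y => ?_) z
  simp only [ContinuousLinearMap.comp_apply]
  rw [hmap_htmul, slice_htmul, slice_htmul, map_smul, ContinuousLinearMap.adjoint_inner_left]

theorem slice_hmap_id (V : F →L[ℂ] H) (c : E) (z : HTensor E F) :
    slice H c (hmap (ContinuousLinearMap.id ℂ E) V z) = V (slice F c z) := by
  rw [slice_hmap, ContinuousLinearMap.adjoint_id]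
  rfl

theorem slice_slice_hassoc (c : E) (d : F) (z : HTensor (HTensor E F) G) :
    slice G d (slice (HTensor F G) c (hassoc E F G z)) = slice G (htmul c d) z := by
  refine ext_inner_left ℂ fun x => ?_
  rw [inner_slice_right, inner_slice_right, inner_slice_right, ← hassoc_htmul,
    LinearIsometryEquiv.inner_map_map]

theorem slice_hassoc_htmul (c : E) (w : HTensor E F) (g : G) :
    slice (HTensor F G) c (hassoc E F G (htmul w g)) = htmul (slice F c w) g := by
  refine ext_slice fun d => ?_
  rw [slice_slice_hassoc, slice_htmul, slice_htmul, inner_slice_right]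

theorem slice_smul (r : ℂ) (c : E) (z : HTensor E F) :
    slice F (r • c) z = star r • slice F c z := by
  rw [slice, map_smul, map_smulₛₗ]
  rfl

/-- Parseval in the product basis, with the sum over the basis of the second factor already carried
out. -/
theorem hasSum_inner_slice {ι : Type*} (d : HilbertBasis ι ℂ E) (z w : HTensor E F) :
    HasSum (fun j => inner ℂ (slice F (d j) z) (slice F (d j) w)) (inner ℂ z w) := by
  refine ((tensorBasis d (stdBasis F)).hasSum_inner_mul_inner z w).prod_fiberwise fun j => ?_
  refine ((stdBasis F).hasSum_inner_mul_inner (slice F (d j) z) (slice F (d j) w)).congr_fun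
    fun k => ?_
  rw [tensorBasis_apply, inner_slice_left, inner_slice_right]

end Slices

/-! ### Traces and partial traces -/

section Traces

variable {E F H K : Type*}
  [NormedAddCommGroup E] [InnerProductSpace ℂ E] [CompleteSpace E]
  [NormedAddCommGroup F] [InnerProductSpace ℂ F] [CompleteSpace F]
  [NormedAddCommGroup H] [InnerProductSpace ℂ H] [CompleteSpace H]
  [NormedAddCommGroup K] [InnerProductSpace ℂ K] [CompleteSpace K]

theorem isNuclearRep_ketbra (x y : H) :
    IsNuclearRep (ketbra x y).1 (fun _ : Unit => x) (fun _ : Unit => y) where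
  summable := (hasSum_fintype _).summable
  hasSum v := by
    convert hasSum_fintype (fun _ : Unit => inner ℂ y v • x)
    simp [ketbra_apply]

/-- The right side does not involve the basis `b`: this is basis independence of the trace, by
interchanging an absolutely convergent double series. -/
theorem IsNuclearRep.hasSum_inner {ι κ : Type*} {V : H →L[ℂ] H} {x y : ι → H}
    (h : IsNuclearRep V x y) (b : HilbertBasis κ ℂ H) :
    HasSum (fun i => inner ℂ (b i) (V (b i))) (∑' n, inner ℂ (y n) (x n)) := by
  -- Cauchy–Schwarz and Bessel bound the sum over the basis by ‖y n‖ ‖x n‖ for each n.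
  have hs : Summable fun p : ι × κ => ‖inner ℂ (y p.1) (b p.2)‖ * ‖inner ℂ (b p.2) (x p.1)‖ := by
    refine summable_prod_of_sum_le (fun p => by positivity) h.summable fun n s =>
      (sum_mul_le (norm_nonneg (y n)) (norm_nonneg (x n)) (fun s => ?_) (fun s => ?_) s).trans_eq
        (mul_comm _ _)
    · exact (Finset.sum_congr rfl fun i _ => by rw [norm_inner_symm]).trans_le
        (b.orthonormal.sum_inner_products_le (y n))
    · exact b.orthonormal.sum_inner_products_le (x n)
  have hs' : Summable fun p : ι × κ => inner ℂ (y p.1) (b p.2) * inner ℂ (b p.2) (x p.1) :=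
    Summable.of_norm (hs.congr fun p => by rw [norm_mul])
  have h1 := hs'.hasSum.prod_fiberwise fun n => b.hasSum_inner_mul_inner (y n) (x n)
  have h2 := ((Equiv.prodComm κ ι).hasSum_iff.2 hs'.hasSum)
  rw [← h1.tsum_eq] at h2
  refine h2.prod_fiberwise fun i => ?_
  refine HasSum.congr_fun ((innerSL ℂ (b i)).hasSum (h.hasSum (b i))) fun n => ?_
  rw [map_smul]
  rfl

theorem hasSum_trace {κ : Type*} (b : HilbertBasis κ ℂ H) (ρ : traceClass H) :
    HasSum (fun i => inner ℂ (b i) (ρ.1 (b i))) (trace ρ) := by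
  obtain ⟨x, y, h⟩ := IsTraceClass.exists_rep ρ.2
  rw [trace, (h.hasSum_inner (stdBasis H)).tsum_eq]
  exact h.hasSum_inner b

theorem IsNuclearRep.trace_eq {ι : Type*} {ρ : traceClass H} {x y : ι → H}
    (h : IsNuclearRep ρ.1 x y) : trace ρ = ∑' n, inner ℂ (y n) (x n) :=
  (h.hasSum_inner (stdBasis H)).tsum_eq

theorem trace_ketbra (x y : H) : trace (ketbra x y) = inner ℂ y x := by
  rw [(isNuclearRep_ketbra x y).trace_eq]
  exact (hasSum_unique (fun _ : Unit => inner ℂ y x)).tsum_eq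

theorem IsNuclearRep.hasSum_inner_htmul {ι κ : Type*} {V : HTensor E F →L[ℂ] HTensor E F}
    {x y : ι → HTensor E F} (h : IsNuclearRep V x y) (b : HilbertBasis κ ℂ F) (c c' : E) :
    HasSum (fun j => inner ℂ (htmul c (b j)) (V (htmul c' (b j))))
      (∑' n, inner ℂ (slice F c' (y n)) (slice F c (x n))) := by
  refine ((h.conj (slice F c) (slice F c')).hasSum_inner b).congr_fun fun j => ?_
  rw [ContinuousLinearMap.comp_apply, inner_slice_right,
    show ContinuousLinearMap.adjoint (slice F c') = htmulL E F c' from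
      ContinuousLinearMap.adjoint_adjoint _]
  rfl

/-- `ptraceOp` is a norm-convergent series over one fixed basis. Its matrix element at c, c' is the
trace of V compressed by the slices at c and c', a nuclear operator on F, so any orthonormal basis
of F may be used. -/
theorem hasSum_ptrace {κ : Type*} (b : HilbertBasis κ ℂ F) (ρ : traceClass (HTensor E F))
    (c c' : E) :
    HasSum (fun j => inner ℂ (htmul c (b j)) (ρ.1 (htmul c' (b j))))
      (inner ℂ c ((ptrace E F ρ).1 c')) := by
  obtain ⟨x, y, h⟩ := IsTraceClass.exists_rep ρ.2
  have h1 := ((innerSL ℂ c) ∘L (ContinuousLinearMap.apply ℂ E c')).hasSum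
    (summable_ptrace ρ.2).hasSum
  have h2 : inner ℂ c ((ptrace E F ρ).1 c') =
      ∑' n, inner ℂ (slice F c' (y n)) (slice F c (x n)) :=
    h1.unique ((h.hasSum_inner_htmul (stdBasis F) c c').congr_fun fun j =>
      ContinuousLinearMap.adjoint_inner_right _ _ _)
  rw [h2]
  exact h.hasSum_inner_htmul b c c'

/-- Parseval in F. This is the source of the Gram form of a channel. -/
theorem inner_ptrace_ketbra (z z' : HTensor E F) (c c' : E) :
    inner ℂ c ((ptrace E F (ketbra z z')).1 c') = inner ℂ (slice F c' z') (slice F c z) := by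
  refine (hasSum_ptrace (stdBasis F) (ketbra z z') c c').unique ?_
  refine ((stdBasis F).hasSum_inner_mul_inner (slice F c' z') (slice F c z)).congr_fun fun j => ?_
  rw [ketbra_apply, inner_smul_right, inner_slice_left, inner_slice_right]

theorem ptrace_ketbra_htmul (e e' : E) (f f' : F) :
    ptrace E F (ketbra (htmul e f) (htmul e' f')) = (inner ℂ f' f : ℂ) • ketbra e e' := by
  refine Subtype.ext (ContinuousLinearMap.ext fun c' => ext_inner_left ℂ fun c => ?_)
  rw [inner_ptrace_ketbra, slice_htmul, slice_htmul, inner_smul_left, inner_smul_right,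
    inner_conj_symm]
  change _ = inner ℂ c ((inner ℂ f' f : ℂ) • (ketbra e e').1 c')
  rw [ketbra_apply, inner_smul_right, inner_smul_right]
  ring

theorem trace_ptrace (ρ : traceClass (HTensor E F)) : trace (ptrace E F ρ) = trace ρ := by
  refine (hasSum_trace (stdBasis E) _).unique ?_
  refine (hasSum_trace (tensorBasis (stdBasis E) (stdBasis F)) ρ).prod_fiberwise fun i => ?_
  simp_rw [tensorBasis_apply]
  exact hasSum_ptrace (stdBasis F) ρ _ _

theorem isCPTP_ptrace : IsCPTP (ptrace E F) where
  completelyPositive n ρ hρ x := by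
    have h : HasSum (fun k => ∑ i, ∑ j, inner ℂ (htmul (x i) (stdBasis F k))
        ((ρ i j).1 (htmul (x j) (stdBasis F k))))
        (∑ i, ∑ j, inner ℂ (x i) ((ptrace E F (ρ i j)).1 (x j))) :=
      hasSum_sum fun i _ => hasSum_sum fun j _ => hasSum_ptrace (stdBasis F) (ρ i j) (x i) (x j)
    -- Each term of the series is the positivity of the block ρ tested on the vectors x i ⊗ |k⟩.
    exact h.nonneg fun k => hρ fun i => htmul (x i) (stdBasis F k)
  trace_preserving := trace_ptrace

theorem conjBy_apply (U : H →L[ℂ] K) (ρ : traceClass H) (v : K) :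
    (conjBy U ρ).1 v = U (ρ.1 (ContinuousLinearMap.adjoint U v)) := rfl

theorem conjBy_ketbra (U : H →L[ℂ] K) (x y : H) : conjBy U (ketbra x y) = ketbra (U x) (U y) := by
  refine Subtype.ext (ContinuousLinearMap.ext fun v => ?_)
  rw [conjBy_apply, ketbra_apply, ketbra_apply, map_smul, ContinuousLinearMap.adjoint_inner_right]

theorem trace_conjBy {U : H →L[ℂ] K} (hU : ∀ x y, inner ℂ (U x) (U y) = inner ℂ x y)
    (ρ : traceClass H) : trace (conjBy U ρ) = trace ρ := by
  obtain ⟨x, y, h⟩ := IsTraceClass.exists_rep ρ.2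
  have h' : IsNuclearRep (conjBy U ρ).1 (fun n => U (x n)) (fun n => U (y n)) := h.conj U U
  rw [h.trace_eq, h'.trace_eq]
  simp_rw [hU]

theorem isCPTP_conjBy {U : H →L[ℂ] K} (hU : ∀ x y, inner ℂ (U x) (U y) = inner ℂ x y) :
    IsCPTP (conjBy U) where
  completelyPositive n ρ hρ x := by
    refine (hρ fun i => ContinuousLinearMap.adjoint U (x i)).trans_eq ?_
    refine Finset.sum_congr rfl fun i _ => Finset.sum_congr rfl fun j _ => ?_
    rw [conjBy_apply, ContinuousLinearMap.adjoint_inner_left]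
  trace_preserving := trace_conjBy hU

theorem conjBy_comp (U : H →L[ℂ] K) (V : K →L[ℂ] E) (ρ : traceClass H) :
    conjBy V (conjBy U ρ) = conjBy (V ∘L U) ρ := by
  refine Subtype.ext (ContinuousLinearMap.ext fun v => ?_)
  simp only [conjBy_apply, ContinuousLinearMap.adjoint_comp, ContinuousLinearMap.comp_apply]

theorem conjBy_ptrace (f : E →L[ℂ] H) (σ : traceClass (HTensor E F)) :
    conjBy f (ptrace E F σ) = ptrace H F (conjBy (hmap f (ContinuousLinearMap.id ℂ F)) σ) := by
  refine Subtype.ext (ContinuousLinearMap.ext fun c' => ext_inner_left ℂ fun c => ?_)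
  rw [conjBy_apply, ← ContinuousLinearMap.adjoint_inner_left]
  refine (hasSum_ptrace (stdBasis F) σ _ _).unique
    ((hasSum_ptrace (stdBasis F) _ c c').congr_fun fun j => ?_)
  have h : ∀ (c : H) (y : F), ContinuousLinearMap.adjoint (hmap f (ContinuousLinearMap.id ℂ F))
      (htmul c y) = htmul (ContinuousLinearMap.adjoint f c) y := fun c y => by
    refine ext_inner_right ℂ fun z => ?_
    rw [ContinuousLinearMap.adjoint_inner_left, ← inner_slice_right, ← inner_slice_right,
      slice_hmap, ContinuousLinearMap.id_apply]
  rw [conjBy_apply, ← h, ← h, ContinuousLinearMap.adjoint_inner_left]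

theorem IsCPTP.comp {Φ : traceClass H →ₗ[ℂ] traceClass K} {Ψ : traceClass K →ₗ[ℂ] traceClass E}
    (hΨ : IsCPTP Ψ) (hΦ : IsCPTP Φ) : IsCPTP (Ψ ∘ₗ Φ) where
  completelyPositive n ρ hρ := hΨ.completelyPositive n _ (hΦ.completelyPositive n ρ hρ)
  trace_preserving ρ := (hΨ.trace_preserving _).trans (hΦ.trace_preserving ρ)

end Traces

/-! ### Kolmogorov decompositions -/

section Gram

variable {E F : Type*}
  [NormedAddCommGroup E] [InnerProductSpace ℂ E]
  [NormedAddCommGroup F] [InnerProductSpace ℂ F] [CompleteSpace F]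

theorem eq_zero_of_inner_eq_zero_of_dense {S : Set F}
    (hS : (Submodule.span ℂ S).topologicalClosure = ⊤) {r : F} (hr : ∀ x ∈ S, inner ℂ x r = 0) :
    r = 0 := by
  have h : r ∈ (Submodule.span ℂ S)ᗮ := by
    rw [Submodule.mem_orthogonal]
    intro u hu
    induction hu using Submodule.span_induction with
    | mem x hx => exact hr x hx
    | zero => exact inner_zero_left _
    | add a b _ _ ha hb => rw [inner_add_left, ha, hb, add_zero]
    | smul c a _ ha => rw [inner_smul_left, ha, mul_zero]
  rwa [Submodule.topologicalClosure_eq_top_iff.1 hS, Submodule.mem_bot] at h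

/-- Equal Gram kernels give equal norms for all finite combinations, so sending `f i` to `g i` is
well defined, even when the `f i` are linearly dependent, and extends from the dense span. -/
theorem exists_linearIsometry_of_inner_eq {ι : Type*} {f : ι → E} {g : ι → F}
    (h : ∀ i j, inner ℂ (g i) (g j) = inner ℂ (f i) (f j))
    (hf : (Submodule.span ℂ (Set.range f)).topologicalClosure = ⊤) :
    ∃ V : E →ₗᵢ[ℂ] F, ∀ i, V (f i) = g i := by
  let f' := Finsupp.linearCombination ℂ f
  let g' := Finsupp.linearCombination ℂ g
  have hin : ∀ c, inner ℂ (g' c) (g' c) = inner ℂ (f' c) (f' c) := fun c => by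
    simp only [f', g', Finsupp.linearCombination_apply, Finsupp.sum, sum_inner, inner_sum,
      inner_smul_left, inner_smul_right, h]
  have hn : ∀ c, ‖g' c‖ = ‖f' c‖ := fun c => by
    rw [@norm_eq_sqrt_re_inner ℂ, @norm_eq_sqrt_re_inner ℂ, hin]
  have hd : DenseRange f' := denseRange_of_span f' hf (by
    rintro _ ⟨i, rfl⟩
    exact ⟨Finsupp.single i 1, by simp [f']⟩)
  have hV : ∀ c, g'.extendOfNorm f' (f' c) = g' c :=
    LinearMap.extendOfNorm_eq hd ⟨1, fun c => by rw [one_mul, hn]⟩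
  refine ⟨⟨(g'.extendOfNorm f').toLinearMap, fun x => ?_⟩, fun i => ?_⟩
  · refine hd.induction (P := fun x => ‖g'.extendOfNorm f' x‖ = ‖x‖) ?_ ?_ x
    · rintro _ ⟨c, rfl⟩
      rw [hV, hn]
    · exact isClosed_eq (by fun_prop) continuous_norm
  · have := hV (Finsupp.single i 1)
    simpa [f', g'] using this

theorem kernel_hermitian {X : Type*} {k : X → X → ℂ}
    (hk : ∀ (n : ℕ) (x : Fin n → X) (c : Fin n → ℂ),
      0 ≤ ∑ i, ∑ j, star (c i) * c j * k (x i) (x j)) (x y : X) : star (k y x) = k x y := by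
  have h0 : ∀ x, (k x x).im = 0 := fun x => by
    have := (Complex.nonneg_iff.1 (hk 1 ![x] ![1])).2
    simpa using this.symm
  -- In ℂ, `0 ≤ z` includes that z is real. Weights (1, 1) give opposite imaginary parts of k x y
  -- and k y x; weights (1, i) give equal real parts.
  have h1 := (Complex.nonneg_iff.1 (hk 2 ![x, y] ![1, 1])).2
  have h2 := (Complex.nonneg_iff.1 (hk 2 ![x, y] ![1, Complex.I])).2
  simp [Fin.sum_univ_two, h0] at h1 h2
  apply Complex.ext
  · simp
    linarith
  · simp
    linarith

/-- The space is the reproducing kernel Hilbert space of k, regarded as a kernel of multiplication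
operators on ℂ; `v x` is the kernel function at x applied to 1. -/
theorem exists_kolmogorov {X : Type u} {k : X → X → ℂ}
    (hk : ∀ (n : ℕ) (x : Fin n → X) (c : Fin n → ℂ),
      0 ≤ ∑ i, ∑ j, star (c i) * c j * k (x i) (x j)) :
    ∃ (R : Type u) (_ : NormedAddCommGroup R) (_ : InnerProductSpace ℂ R) (_ : CompleteSpace R)
      (v : X → R), (∀ x y, inner ℂ (v x) (v y) = k x y) ∧
        (Submodule.span ℂ (Set.range v)).topologicalClosure = ⊤ := by
  let M : Matrix X X (ℂ →L[ℂ] ℂ) := .of fun x y => k x y • ContinuousLinearMap.id ℂ ℂ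
  have hM : M.PosSemidef := by
    have htfae : M.PosSemidef ↔ M.IsHermitian ∧ ∀ w : X →₀ ℂ,
        0 ≤ RCLike.re (w.sum fun x a => w.sum fun y b => inner ℂ (M y x a) b) :=
      RKHS.posSemidef_tfae.out 0 2
    refine htfae.2 ⟨?_, fun w => ?_⟩
    · ext x y
      simp only [M, Matrix.conjTranspose_apply, Matrix.of_apply, star_smul, kernel_hermitian hk]
      simp [ContinuousLinearMap.star_eq_adjoint, ContinuousLinearMap.adjoint_id]
    · have h1 := (Complex.nonneg_iff.1 (hk _ (fun i => (w.support.equivFin.symm i).1)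
        (fun i => w (w.support.equivFin.symm i).1))).1
      have h2 : ∀ f : X → ℂ, ∑ i, f (w.support.equivFin.symm i).1 = ∑ x ∈ w.support, f x :=
        fun f => by
          rw [w.support.equivFin.symm.sum_comp (fun x => f x.1), Finset.sum_coe_sort]
      rw [h2 fun x => ∑ j, star (w x) * w (w.support.equivFin.symm j).1 *
        k x (w.support.equivFin.symm j).1] at h1
      simp_rw [fun x => h2 fun y => star (w x) * w y * k x y] at h1
      refine h1.trans_eq (congrArg Complex.re ?_)
      simp only [Finsupp.sum, M, Matrix.of_apply]
      refine Finset.sum_congr rfl fun x _ => Finset.sum_congr rfl fun y _ => ?_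
      rw [← kernel_hermitian hk x y]
      simp
      ring
  have : Fact M.PosSemidef := ⟨hM⟩
  refine ⟨RKHS.OfKernel M, inferInstance, inferInstance, inferInstance,
    fun x => RKHS.kerFun (RKHS.OfKernel M) x 1, fun x y => ?_, ?_⟩
  · rw [← RKHS.kernel_inner, RKHS.OfKernel.kernel_ofKernel]
    simpa [M] using kernel_hermitian hk x y
  · rw [eq_top_iff, ← RKHS.kerFun_dense (RKHS.OfKernel M)]
    refine Submodule.topologicalClosure_mono (Submodule.span_le.2 ?_)
    rintro _ ⟨x, v, rfl⟩
    have : v = v • (1 : ℂ) := by simp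
    rw [this, map_smul]
    exact Submodule.smul_mem _ _ (Submodule.subset_span ⟨x, rfl⟩)

end Gram

/-! ### Dilations of completely positive maps -/

section Dilation

variable {H K R : Type*}
  [NormedAddCommGroup H] [InnerProductSpace ℂ H] [CompleteSpace H]
  [NormedAddCommGroup K] [InnerProductSpace ℂ K] [CompleteSpace K]
  [NormedAddCommGroup R] [InnerProductSpace ℂ R] [CompleteSpace R]

theorem isPositiveBlock_ketbra {n : ℕ} (h : Fin n → H) :
    IsPositiveBlock fun i j => ketbra (h i) (h j) := fun x => by
  have h1 : ∑ i, ∑ j, inner ℂ (x i) ((ketbra (h i) (h j)).1 (x j)) =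
      (∑ i, inner ℂ (h i) (x i)) * star (∑ i, inner ℂ (h i) (x i)) := by
    rw [mul_comm, star_sum, Finset.sum_mul_sum]
    refine Finset.sum_congr rfl fun i _ => Finset.sum_congr rfl fun j _ => ?_
    rw [ketbra_apply, inner_smul_right, mul_comm]
    congr 1
    exact (inner_conj_symm _ _).symm
  rw [h1]
  exact mul_star_self_nonneg _

/-- The Kolmogorov vectors v (k, h) of the kernel of Φ are meant to be the slices of U h, so U h is
assembled as ∑ e_j ⊗ v (e_j, h). The ancilla stays in the universe of H and K, as the existential
clauses of the theorem need. -/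
theorem exists_dilation {H K : Type u}
    [NormedAddCommGroup H] [InnerProductSpace ℂ H] [CompleteSpace H]
    [NormedAddCommGroup K] [InnerProductSpace ℂ K] [CompleteSpace K]
    {Φ : traceClass H →ₗ[ℂ] traceClass K} (hΦ : IsCPTP Φ) :
    ∃ (R : Type u) (_ : NormedAddCommGroup R) (_ : InnerProductSpace ℂ R) (_ : CompleteSpace R)
      (U : H →ₗᵢ[ℂ] HTensor K R),
      (∀ k k' h h', inner ℂ k ((Φ (ketbra h h')).1 k') =
        inner ℂ (slice R k' (U h')) (slice R k (U h))) ∧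
      (Submodule.span ℂ (Set.range fun p : K × H => slice R p.1 (U p.2))).topologicalClosure =
        ⊤ := by
  obtain ⟨R, _, _, _, v, hv, hd⟩ := exists_kolmogorov (X := K × H)
    (k := fun p q => inner ℂ q.1 ((Φ (ketbra q.2 p.2)).1 p.1)) fun n x c => by
      -- The kernel is written with its arguments exchanged, so that `inner (v p) (v q)` is linear
      -- in q. The weights therefore enter as conjugates and the double sum is transposed.
      refine (hΦ.completelyPositive n _ (isPositiveBlock_ketbra fun i => (x i).2)
        fun i => star (c i) • (x i).1).trans_eq ?_
      rw [Finset.sum_comm]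
      refine Finset.sum_congr rfl fun i _ => Finset.sum_congr rfl fun j _ => ?_
      rw [map_smul, inner_smul_left, inner_smul_right]
      simp
      ring
  have hort : OrthogonalFamily ℂ (fun _ : basisSet K => R) fun j =>
      ((htmulL K R (stdBasis K j)).toLinearMap.isometryOfInner fun x y => by
        change inner ℂ (htmul (stdBasis K j) x) (htmul (stdBasis K j) y) = _
        rw [inner_htmul, inner_self_eq_norm_sq_to_K, (stdBasis K).orthonormal.1 j]
        simp) := by
    intro i j hij x y
    change inner ℂ (htmul (stdBasis K i) x) (htmul (stdBasis K j) y) = _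
    rw [inner_htmul, (stdBasis K).orthonormal.2 hij, zero_mul]
  have hsum : ∀ h, ∃ z : HTensor K R,
      HasSum (fun j => htmul (stdBasis K j) (v (stdBasis K j, h))) z := fun h => by
    -- The terms are pairwise orthogonal, and their squared norms are the diagonal entries of
    -- Φ(|h⟩⟨h|), whose sum is its trace.
    refine (hort.summable_iff_norm_sq_summable fun j => v (stdBasis K j, h)).2 ?_
    refine (Complex.reCLM.summable (hasSum_trace (stdBasis K) (Φ (ketbra h h))).summable).congr
      fun j => ?_
    rw [@norm_sq_eq_re_inner ℂ, hv]
    rfl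
  choose g hg using hsum
  have hgs : ∀ k h, slice R k (g h) = v (k, h) := fun k h => by
    have hslice := (slice R k).hasSum (hg h)
    simp_rw [slice_htmul] at hslice
    -- Testing against the total family v p reduces the claim to the expansion of k in the basis of
    -- K.
    refine sub_eq_zero.1 (eq_zero_of_inner_eq_zero_of_dense hd ?_)
    rintro _ ⟨p, rfl⟩
    rw [inner_sub_right, sub_eq_zero, hv]
    refine ((innerSL ℂ (v p)).hasSum hslice).unique ?_
    refine ((stdBasis K).hasSum_inner_mul_inner k ((Φ (ketbra h p.2)).1 p.1)).congr_fun fun j => ?_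
    rw [map_smul, innerSL_apply_apply, hv, smul_eq_mul]
  -- Trace preservation says that g preserves inner products. Taking the identity of H as the first
  -- family then yields linearity of g at no cost.
  obtain ⟨U, hU⟩ := exists_linearIsometry_of_inner_eq (f := fun h : H => h) (g := g)
    (fun h' h => by
      rw [← trace_ketbra h h', ← hΦ.trace_preserving]
      refine (hasSum_inner_slice (stdBasis K) (g h') (g h)).unique ?_
      simp_rw [hgs, hv]
      exact hasSum_trace _ _)
    (by
      rw [Set.range_id', Submodule.span_univ, eq_top_iff]
      exact Submodule.le_topologicalClosure _)
  refine ⟨R, _, _, ‹_›, U, fun k k' h h' => ?_, ?_⟩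
  · rw [hU, hU, hgs, hgs, hv]
  · simp_rw [hU, hgs]
    exact hd

theorem minimal_of_dense_slices {U : H →L[ℂ] HTensor K R}
    (h : (Submodule.span ℂ (Set.range fun p : K × H => slice R p.1 (U p.2))).topologicalClosure =
      ⊤) :
    (Submodule.span ℂ {z : HTensor K R | ∃ (X : K →L[ℂ] K) (h : H),
      z = hmap X (ContinuousLinearMap.id ℂ R) (U h)}).topologicalClosure = ⊤ := by
  rw [eq_top_iff, ← dense_span_htmul (S := Set.univ) (by simp)
    ((Submodule.dense_iff_topologicalClosure_eq_top).2 h)]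
  refine Submodule.topologicalClosure_mono (Submodule.span_mono ?_)
  rintro _ ⟨e, -, _, ⟨⟨k, x⟩, rfl⟩, rfl⟩
  -- The operator |e⟩⟨k| ⊗ I turns U x into e ⊗ (slice of U x at k).
  refine ⟨InnerProductSpace.rankOne ℂ e k, x, ext_slice fun c => ?_⟩
  rw [slice_hmap, slice_htmul, InnerProductSpace.adjoint_rankOne,
    InnerProductSpace.rankOne_apply, slice_smul, ContinuousLinearMap.id_apply]
  congr 1
  exact (inner_conj_symm _ _).symm

/-- If r is orthogonal to all slices, then k ⊗ r is orthogonal to every (X ⊗ I) U x, because the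
slice of that vector at k is the slice of U x at X⋆ k. Some k ≠ 0 is needed: for K = 0 minimality
puts no constraint on R. -/
theorem dense_slices_of_minimal [Nontrivial K] {U : H →L[ℂ] HTensor K R}
    (h : (Submodule.span ℂ {z : HTensor K R | ∃ (X : K →L[ℂ] K) (h : H),
      z = hmap X (ContinuousLinearMap.id ℂ R) (U h)}).topologicalClosure = ⊤) :
    (Submodule.span ℂ (Set.range fun p : K × H => slice R p.1 (U p.2))).topologicalClosure =
      ⊤ := by
  rw [Submodule.topologicalClosure_eq_top_iff, Submodule.eq_bot_iff]
  intro r hr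
  obtain ⟨k, hk⟩ := exists_ne (0 : K)
  have h1 : htmul k r = 0 := by
    refine eq_zero_of_inner_eq_zero_of_dense h ?_
    rintro _ ⟨X, x, rfl⟩
    rw [← inner_slice_left, slice_hmap]
    exact (Submodule.mem_orthogonal _ _).1 hr _ (Submodule.subset_span ⟨(_, x), rfl⟩)
  have h2 := inner_htmul k k r r
  rw [h1, inner_zero_left] at h2
  exact inner_self_eq_zero.1 ((mul_eq_zero.1 h2.symm).resolve_left (inner_self_ne_zero.2 hk))

end Dilation

/-! ### Channels are determined by their values on rank one operators -/

section Determined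

variable {H K : Type*}
  [NormedAddCommGroup H] [InnerProductSpace ℂ H] [CompleteSpace H]
  [NormedAddCommGroup K] [InnerProductSpace ℂ K] [CompleteSpace K]

theorem exists_isNuclearRep {ι : Type*} {x y : ι → H} (h : Summable fun n => ‖x n‖ * ‖y n‖) :
    ∃ ρ : traceClass H, IsNuclearRep ρ.1 x y := by
  let T : ι → H →L[ℂ] H := fun n => InnerProductSpace.rankOne ℂ (x n) (y n)
  have hs : Summable T := Summable.of_norm (h.congr fun n => by
    simp only [T, InnerProductSpace.norm_rankOne])
  have hr : IsNuclearRep (∑' n, T n) x y := by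
    refine ⟨h, fun v => ?_⟩
    have h1 := (ContinuousLinearMap.apply ℂ H v).hasSum hs.hasSum
    simpa only [ContinuousLinearMap.apply_apply, T, InnerProductSpace.rankOne_apply] using h1
  exact ⟨⟨∑' n, T n, hr.isTraceClass⟩, hr⟩

theorem IsNuclearRep.inner_nonneg {ι : Type*} {V : H →L[ℂ] H} {z : ι → H}
    (h : IsNuclearRep V z z) (v : H) : 0 ≤ inner ℂ v (V v) := by
  refine ((innerSL ℂ v).hasSum (h.hasSum v)).nonneg fun n => ?_
  rw [map_smul, innerSL_apply_apply, smul_eq_mul, ← inner_conj_symm]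
  exact star_mul_self_nonneg _

theorem IsCPTP.inner_nonneg {Φ : traceClass H →ₗ[ℂ] traceClass K} (hΦ : IsCPTP Φ)
    {ρ : traceClass H} (hρ : ∀ v, 0 ≤ inner ℂ v (ρ.1 v)) (v : K) : 0 ≤ inner ℂ v ((Φ ρ).1 v) := by
  have h := hΦ.completelyPositive 1 (fun _ _ => ρ) (fun x => by simpa using hρ (x 0)) fun _ => v
  simpa using h

theorem norm_inner_le_trace {ρ : traceClass H} (hρ : ∀ v, 0 ≤ inner ℂ v (ρ.1 v)) {v : H}
    (hv : ‖v‖ = 1) : ‖inner ℂ v (ρ.1 v)‖ ≤ ‖trace ρ‖ := by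
  have ho : Orthonormal ℂ ((↑) : ({v} : Set H) → H) := by
    refine ⟨fun i => ?_, fun i j hij => (hij (Subsingleton.elim i j)).elim⟩
    rw [Set.mem_singleton_iff.1 i.2, hv]
  -- Once v belongs to an orthonormal basis, its diagonal entry is one nonnegative term of the
  -- trace.
  obtain ⟨w, b, hw, hb⟩ := ho.exists_hilbertBasis_extension
  have hle := le_hasSum (hasSum_trace b ρ) ⟨v, hw rfl⟩ fun j _ => hρ _
  rw [hb] at hle
  exact CStarAlgebra.norm_le_norm_of_nonneg_of_le (hρ v) hle

theorem IsNuclearRep.compl {ι : Type*} {ρ : traceClass H} {x y : ι → H}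
    (h : IsNuclearRep ρ.1 x y) (s : Finset ι) :
    IsNuclearRep (ρ - ∑ n ∈ s, ketbra (x n) (y n)).1 (fun n : {n // n ∉ s} => x n)
      (fun n : {n // n ∉ s} => y n) where
  summable := h.summable.subtype _
  hasSum v := by
    refine (s.hasSum_compl_iff (f := fun n => inner ℂ (y n) v • x n)).2 ?_
    convert h.hasSum v using 1
    simp [ketbra_apply]

/-- A substitute for continuity of Φ: the remainder of a positive nuclear series is positive, so the
diagonal entries of its image are at most the trace of the image, which equals the trace of the
remainder and tends to 0. -/
theorem IsCPTP.hasSum_inner {ι : Type*} {Φ : traceClass H →ₗ[ℂ] traceClass K} (hΦ : IsCPTP Φ)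
    {ρ : traceClass H} {z : ι → H} (h : IsNuclearRep ρ.1 z z) {v : K} (hv : ‖v‖ = 1) :
    HasSum (fun n => inner ℂ v ((Φ (ketbra (z n) (z n))).1 v)) (inner ℂ v ((Φ ρ).1 v)) := by
  rw [HasSum, tendsto_iff_norm_sub_tendsto_zero]
  have hlim := (tendsto_tsum_compl_atTop_zero fun n => inner ℂ (z n) (z n)).norm
  rw [norm_zero] at hlim
  refine squeeze_zero (fun _ => norm_nonneg _) (fun s => ?_) hlim
  have hle := norm_inner_le_trace (hΦ.inner_nonneg (h.compl s).inner_nonneg) hv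
  rw [hΦ.trace_preserving, (h.compl s).trace_eq] at hle
  refine le_trans (le_of_eq ?_) hle
  rw [norm_sub_rev]
  congr 1
  simp

/-- Replacing (x, y) by (t x, t⁻¹ y) with t² = ‖y‖ / ‖x‖ keeps |x⟩⟨y| and balances the norms.
Summability of ‖x n‖ ‖y n‖ then becomes square summability of both families. -/
theorem exists_rescale (x y : H) : ∃ x' y' : H, ‖x'‖ ^ 2 = ‖x‖ * ‖y‖ ∧ ‖y'‖ ^ 2 = ‖x‖ * ‖y‖ ∧
    ∀ v, (inner ℂ y' v : ℂ) • x' = (inner ℂ y v : ℂ) • x := by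
  rcases eq_or_ne x 0 with rfl | hx
  · exact ⟨0, 0, by simp⟩
  rcases eq_or_ne y 0 with rfl | hy
  · exact ⟨0, 0, by simp⟩
  have hx' := norm_pos_iff.2 hx
  have hy' := norm_pos_iff.2 hy
  have ht : 0 < √(‖y‖ / ‖x‖) := Real.sqrt_pos.2 (by positivity)
  have ht2 : √(‖y‖ / ‖x‖) ^ 2 = ‖y‖ / ‖x‖ := Real.sq_sqrt (by positivity)
  refine ⟨((√(‖y‖ / ‖x‖) : ℝ) : ℂ) • x, ((√(‖y‖ / ‖x‖) : ℝ) : ℂ)⁻¹ • y, ?_, ?_, fun v => ?_⟩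
  · rw [norm_smul, mul_pow, Complex.norm_real, Real.norm_of_nonneg ht.le, ht2]
    field_simp
  · rw [norm_smul, mul_pow, norm_inv, Complex.norm_real, Real.norm_of_nonneg ht.le, inv_pow, ht2]
    field_simp
  · rw [inner_smul_left, smul_smul, map_inv₀, Complex.conj_ofReal, mul_right_comm,
      inv_mul_cancel₀ (Complex.ofReal_ne_zero.2 ht.ne'), one_mul]

theorem exists_four_positive (ρ : traceClass H) :
    ∃ (z : Fin 4 → basisSet H → H) (P : Fin 4 → traceClass H) (c : Fin 4 → ℂ),
      (∀ k, IsNuclearRep (P k).1 (z k) (z k)) ∧ ρ = ∑ k, c k • P k := by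
  obtain ⟨x₀, y₀, h⟩ := IsTraceClass.exists_rep ρ.2
  choose x y hx hy hxy using fun n => exists_rescale (x₀ n) (y₀ n)
  have hsx : Summable fun n => ‖x n‖ ^ 2 := h.summable.congr fun n => (hx n).symm
  have hsy : Summable fun n => ‖y n‖ ^ 2 := h.summable.congr fun n => (hy n).symm
  -- Polarization: |x⟩⟨y| = ¼ ∑ c |x + c y⟩⟨x + c y| over the fourth roots of unity c.
  let c : Fin 4 → ℂ := ![1, Complex.I, -1, -Complex.I]
  have hc : ∀ k, ‖c k‖ = 1 := by
    intro k
    fin_cases k <;> simp [c]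
  have hz : ∀ k, ∃ P : traceClass H,
      IsNuclearRep P.1 (fun n => x n + c k • y n) (fun n => x n + c k • y n) := fun k => by
    refine exists_isNuclearRep (Summable.of_nonneg_of_le (fun n => by positivity) (fun n => ?_)
      ((hsx.add hsy).mul_left 2))
    have h1 : ‖x n + c k • y n‖ ≤ ‖x n‖ + ‖y n‖ := by
      refine (norm_add_le _ _).trans_eq ?_
      rw [norm_smul, hc, one_mul]
    nlinarith [sq_nonneg (‖x n‖ - ‖y n‖), norm_nonneg (x n + c k • y n)]
  choose P hP using hz
  refine ⟨fun k n => x n + c k • y n, P, fun k => (1 / 4 : ℂ) * c k, hP, ?_⟩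
  refine Subtype.ext (ContinuousLinearMap.ext fun v => ?_)
  refine (h.hasSum v).unique ?_
  have h1 := hasSum_sum (s := Finset.univ) fun k (_ : k ∈ Finset.univ) =>
    ((hP k).hasSum v).const_smul ((1 / 4 : ℂ) * c k)
  have h2 : (∑ k, ((1 / 4 : ℂ) * c k) • P k).1 v = ∑ k, ((1 / 4 : ℂ) * c k) • (P k).1 v := by
    simp
  rw [h2]
  refine h1.congr_fun fun n => ?_
  rw [← hxy]
  simp only [Fin.sum_univ_four, c, inner_add_left, inner_smul_left, smul_add, smul_smul]
  simp
  match_scalars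
  · linear_combination (inner ℂ (y n) v / 2) * Complex.I_sq
  · ring_nf
    simp [Complex.I_sq]

theorem IsCPTP.ext_ketbra {Φ Ψ : traceClass H →ₗ[ℂ] traceClass K} (hΦ : IsCPTP Φ)
    (hΨ : IsCPTP Ψ) (h : ∀ x y, Φ (ketbra x y) = Ψ (ketbra x y)) : Φ = Ψ := by
  refine LinearMap.ext fun ρ => ?_
  obtain ⟨z, P, c, hP, rfl⟩ := exists_four_positive ρ
  rw [map_sum, map_sum]
  refine Finset.sum_congr rfl fun k _ => ?_
  rw [map_smul, map_smul]
  congr 1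
  -- Over ℂ an operator is determined by its quadratic form, hence by the values of that form on
  -- unit vectors.
  refine Subtype.ext (ContinuousLinearMap.coe_injective ((ext_inner_map _ _).1 fun v => ?_))
  have key : ∀ v : K, ‖v‖ = 1 → inner ℂ v ((Φ (P k)).1 v) = inner ℂ v ((Ψ (P k)).1 v) :=
    fun v hv => by
      refine (hΦ.hasSum_inner (hP k) hv).unique ?_
      simp_rw [h]
      exact hΨ.hasSum_inner (hP k) hv
  rcases eq_or_ne v 0 with rfl | hv
  · simp
  · have h1 := key ((‖v‖ : ℂ)⁻¹ • v) (by
      rw [norm_smul, norm_inv, Complex.norm_real, norm_norm, inv_mul_cancel₀ (norm_ne_zero_iff.2 hv)])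
    have hne : (‖v‖ : ℂ)⁻¹ ≠ 0 := inv_ne_zero (Complex.ofReal_ne_zero.2 (norm_ne_zero_iff.2 hv))
    simp only [map_smul, inner_smul_left, inner_smul_right, map_inv₀, Complex.conj_ofReal] at h1
    have h2 := mul_left_cancel₀ hne (mul_left_cancel₀ hne h1)
    change inner ℂ ((Φ (P k)).1 v) v = inner ℂ ((Ψ (P k)).1 v) v
    rw [← inner_conj_symm, h2, inner_conj_symm]

end Determined

/-! ### Reduction to dense families, and existence of minimal Stinespring representations -/

section Stinespring

variable {H K : Type u}
  [NormedAddCommGroup H] [InnerProductSpace ℂ H] [CompleteSpace H]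
  [NormedAddCommGroup K] [InnerProductSpace ℂ K] [CompleteSpace K]

/-- In terms of a dilation U, matrix elements of Φ(|x⟩⟨y|) are inner products of slices of U x and U
y, hence continuous in each vector. Agreement on S × S extends first in y, then in x. -/
theorem IsCPTP.ext_of_dense {Φ Ψ : traceClass H →ₗ[ℂ] traceClass K} (hΦ : IsCPTP Φ)
    (hΨ : IsCPTP Ψ) {S : Set H} (hS : Dense (Submodule.span ℂ S : Set H))
    (h : ∀ x ∈ S, ∀ y ∈ S, Φ (ketbra x y) = Ψ (ketbra x y)) : Φ = Ψ := by
  obtain ⟨R₁, _, _, _, U₁, hU₁, -⟩ := exists_dilation hΦ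
  obtain ⟨R₂, _, _, _, U₂, hU₂, -⟩ := exists_dilation hΨ
  refine hΦ.ext_ketbra hΨ fun x y =>
    Subtype.ext (ContinuousLinearMap.ext fun k' => ext_inner_left ℂ fun k => ?_)
  have h1 : ∀ x ∈ S, ∀ y, inner ℂ k ((Φ (ketbra x y)).1 k') = inner ℂ k ((Ψ (ketbra x y)).1 k') :=
    fun x hx y => by
      have h2 := ContinuousLinearMap.ext_on hS
        (f := innerSL ℂ (slice R₁ k (U₁ x)) ∘L slice R₁ k' ∘L U₁.toContinuousLinearMap)
        (g := innerSL ℂ (slice R₂ k (U₂ x)) ∘L slice R₂ k' ∘L U₂.toContinuousLinearMap)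
        fun y hy => by
          change inner ℂ (slice R₁ k (U₁ x)) (slice R₁ k' (U₁ y)) =
            inner ℂ (slice R₂ k (U₂ x)) (slice R₂ k' (U₂ y))
          rw [← inner_conj_symm, ← hU₁, h x hx y hy, hU₂, inner_conj_symm]
      have h3 : inner ℂ (slice R₁ k (U₁ x)) (slice R₁ k' (U₁ y)) =
        inner ℂ (slice R₂ k (U₂ x)) (slice R₂ k' (U₂ y)) := DFunLike.congr_fun h2 y
      rw [hU₁, hU₂, ← inner_conj_symm, h3, inner_conj_symm]
  rw [hU₁, hU₂]
  refine DFunLike.congr_fun (ContinuousLinearMap.ext_on hS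
    (f := innerSL ℂ (slice R₁ k' (U₁ y)) ∘L slice R₁ k ∘L U₁.toContinuousLinearMap)
    (g := innerSL ℂ (slice R₂ k' (U₂ y)) ∘L slice R₂ k ∘L U₂.toContinuousLinearMap)
    fun x hx => ?_) x
  exact (hU₁ k k' x y).symm.trans ((h1 x hx y).trans (hU₂ k k' x y))

theorem exists_isMinimalStinespring {Φ : traceClass H →ₗ[ℂ] traceClass K} (hΦ : IsCPTP Φ) :
    ∃ (R : Type u) (_ : NormedAddCommGroup R) (_ : InnerProductSpace ℂ R) (_ : CompleteSpace R)
      (U : H →L[ℂ] HTensor K R), IsMinimalStinespring Φ U := by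
  obtain ⟨R, _, _, _, U, hU, hd⟩ := exists_dilation hΦ
  refine ⟨R, _, _, ‹_›, U.toContinuousLinearMap, fun ρ => ?_, minimal_of_dense_slices hd⟩
  have hΨ : IsCPTP (ptrace K R ∘ₗ conjBy U.toContinuousLinearMap) :=
    isCPTP_ptrace.comp (isCPTP_conjBy U.inner_map_map)
  -- The dilation only gives the values on rank one operators; both sides are CPTP, so these values
  -- decide.
  refine DFunLike.congr_fun (hΦ.ext_ketbra hΨ fun x y => ?_) ρ
  refine Subtype.ext (ContinuousLinearMap.ext fun k' => ext_inner_left ℂ fun k => ?_)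
  rw [hU, LinearMap.comp_apply, conjBy_ketbra, inner_ptrace_ketbra]
  rfl

end Stinespring

/-! ### Complex conjugation -/

section Conjugation

variable {E F : Type*}
  [NormedAddCommGroup E] [InnerProductSpace ℂ E] [CompleteSpace E]
  [NormedAddCommGroup F] [InnerProductSpace ℂ F] [CompleteSpace F]

theorem ext_hilbertBasis {ι : Type*} (a : HilbertBasis ι ℂ E) {x y : E}
    (h : ∀ i, inner ℂ (a i) x = inner ℂ (a i) y) : x = y := by
  refine a.repr.injective (lp.ext (funext fun i => ?_))
  rw [a.repr_apply_apply, a.repr_apply_apply, h]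

theorem inner_basis_conjVec {ι : Type*} (a : HilbertBasis ι ℂ E) (h : E) (i : ι) :
    inner ℂ (a i) (conjVec a h) = star (inner ℂ (a i) h) := by
  rw [← a.repr_apply_apply, ← a.repr_apply_apply, conjVec, LinearIsometryEquiv.apply_symm_apply]
  rfl

theorem conjVec_conjVec {ι : Type*} (a : HilbertBasis ι ℂ E) (h : E) :
    conjVec a (conjVec a h) = h :=
  ext_hilbertBasis a fun i => by rw [inner_basis_conjVec, inner_basis_conjVec, star_star]

theorem inner_conjVec_conjVec {ι : Type*} (a : HilbertBasis ι ℂ E) (x y : E) :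
    inner ℂ (conjVec a x) (conjVec a y) = inner ℂ y x := by
  refine (a.hasSum_inner_mul_inner _ _).unique
    ((a.hasSum_inner_mul_inner y x).congr_fun fun i => ?_)
  rw [inner_basis_conjVec, ← inner_conj_symm, inner_basis_conjVec, ← inner_conj_symm (a i) y]
  simp [mul_comm]

/-- Such a W preserves coordinates up to relabelling, and conjugation acts on coordinates. -/
theorem conjVec_map {ι κ : Type*} (a : HilbertBasis ι ℂ E) (b : HilbertBasis κ ℂ F)
    (e : ι ≃ κ) (W : E ≃ₗᵢ[ℂ] F) (h : ∀ i, W (a i) = b (e i)) (x : E) :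
    conjVec b (W x) = W (conjVec a x) := by
  refine ext_hilbertBasis b fun j => ?_
  obtain ⟨i, rfl⟩ := e.surjective j
  rw [inner_basis_conjVec, ← h, LinearIsometryEquiv.inner_map_map,
    LinearIsometryEquiv.inner_map_map, inner_basis_conjVec]

theorem conjVec_tensorBasis {ι κ : Type*} (a : HilbertBasis ι ℂ E) (b : HilbertBasis κ ℂ F)
    (x : E) (y : F) :
    conjVec (tensorBasis a b) (htmul x y) = htmul (conjVec a x) (conjVec b y) := by
  refine ext_hilbertBasis (tensorBasis a b) fun p => ?_
  rw [inner_basis_conjVec, tensorBasis_apply, inner_htmul, inner_htmul, inner_basis_conjVec,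
    inner_basis_conjVec, star_mul']

end Conjugation

/-! ### Equivalent forms of the causality condition -/

section Causality

variable {A B C D : Type u}
  [NormedAddCommGroup A] [InnerProductSpace ℂ A] [CompleteSpace A]
  [NormedAddCommGroup B] [InnerProductSpace ℂ B] [CompleteSpace B]
  [NormedAddCommGroup C] [InnerProductSpace ℂ C] [CompleteSpace C]
  [NormedAddCommGroup D] [InnerProductSpace ℂ D] [CompleteSpace D]
  {Φ : traceClass (HTensor A B) →ₗ[ℂ] traceClass (HTensor C D)}
  {Ψ : traceClass A →ₗ[ℂ] traceClass C}

/-- Both sides are CPTP and simple tensors span densely, so rank one operators between simple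
tensors suffice. -/
theorem ptrace_comp_eq_iff (hΦ : IsCPTP Φ) (hΨ : IsCPTP Ψ) :
    ptrace C D ∘ₗ Φ = Ψ ∘ₗ ptrace A B ↔ ∀ (e e' : A) (f f' : B) (c c' : C),
      inner ℂ c ((ptrace C D (Φ (ketbra (htmul e f) (htmul e' f')))).1 c') =
        inner ℂ c ((Ψ (ketbra e e')).1 c') * inner ℂ f' f := by
  have key : ∀ (e e' : A) (f f' : B) (c c' : C),
      inner ℂ c (((Ψ ∘ₗ ptrace A B) (ketbra (htmul e f) (htmul e' f'))).1 c') =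
        inner ℂ c ((Ψ (ketbra e e')).1 c') * inner ℂ f' f := fun e e' f f' c c' => by
    rw [LinearMap.comp_apply, ptrace_ketbra_htmul, map_smul]
    change inner ℂ c ((inner ℂ f' f : ℂ) • (Ψ (ketbra e e')).1 c') = _
    rw [inner_smul_right, mul_comm]
  refine ⟨fun h e e' f f' c c' => ?_, fun h => ?_⟩
  · rw [← key, ← h]
    rfl
  · refine (isCPTP_ptrace.comp hΦ).ext_of_dense (hΨ.comp isCPTP_ptrace)
      (dense_span_range_htmul (E := A) (F := B)) ?_
    rintro _ ⟨e, -, f, -, rfl⟩ _ ⟨e', -, f', -, rfl⟩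
    refine Subtype.ext (ContinuousLinearMap.ext fun c' => ext_inner_left ℂ fun c => ?_)
    rw [key, ← h]
    rfl

theorem ptrace_comp_eq_iff_choi (hΦ : IsCPTP Φ) (hΨ : IsCPTP Ψ) {α β : Type u}
    (a : HilbertBasis α ℂ A) (b : HilbertBasis β ℂ B) :
    ptrace C D ∘ₗ Φ = Ψ ∘ₗ ptrace A B ↔
      ∀ (ψA φA : A) (ψB φB : B) (ψC φC : C) (δ : Type u) (d : HilbertBasis δ ℂ D),
        HasSum
          (fun j => choi (tensorBasis a b) Φ
            (htmul ψC (d j) ⊗ₜ[ℂ] htmul ψA ψB) (htmul φC (d j) ⊗ₜ[ℂ] htmul φA φB))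
          (choi a Ψ (ψC ⊗ₜ[ℂ] ψA) (φC ⊗ₜ[ℂ] φA) * inner ℂ ψB φB) := by
  rw [ptrace_comp_eq_iff hΦ hΨ]
  simp_rw [choi_tmul, conjVec_tensorBasis]
  refine ⟨fun h ψA φA ψB φB ψC φC δ d => ?_, fun h e e' f f' c c' => ?_⟩
  · rw [← inner_conjVec_conjVec b φB ψB, ← h]
    exact hasSum_ptrace d _ _ _
  -- Conjugation is an involution, so every choice of kets is reached. One basis of D is enough here
  -- because the sum of the series is already known.
  · have h1 := h (conjVec a e) (conjVec a e') (conjVec b f) (conjVec b f') c c' _ (stdBasis D)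
    simp_rw [conjVec_conjVec, inner_conjVec_conjVec] at h1
    exact (hasSum_ptrace (stdBasis D) _ _ _).unique h1

theorem IsStinespring.inner_ketbra {H K R : Type*}
    [NormedAddCommGroup H] [InnerProductSpace ℂ H] [CompleteSpace H]
    [NormedAddCommGroup K] [InnerProductSpace ℂ K] [CompleteSpace K]
    [NormedAddCommGroup R] [InnerProductSpace ℂ R] [CompleteSpace R]
    {Θ : traceClass H →ₗ[ℂ] traceClass K} {U : H →L[ℂ] HTensor K R} (hU : IsStinespring Θ U)
    (h h' : H) (k k' : K) :
    inner ℂ k ((Θ (ketbra h h')).1 k') = inner ℂ (slice R k' (U h')) (slice R k (U h)) := by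
  rw [hU, conjBy_ketbra, inner_ptrace_ketbra]

variable {Q R : Type u}
  [NormedAddCommGroup Q] [InnerProductSpace ℂ Q] [CompleteSpace Q]
  [NormedAddCommGroup R] [InnerProductSpace ℂ R] [CompleteSpace R]
  {UΦ : HTensor A B →L[ℂ] HTensor (HTensor C D) R} {UΨ : A →L[ℂ] HTensor C Q}

/-- After reassociation U is a dilation of tr_D ∘ Θ with ancilla D ⊗ R. -/
theorem IsStinespring.inner_ptrace_ketbra {H : Type*}
    [NormedAddCommGroup H] [InnerProductSpace ℂ H] [CompleteSpace H]
    {Θ : traceClass H →ₗ[ℂ] traceClass (HTensor C D)} {U : H →L[ℂ] HTensor (HTensor C D) R}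
    (hU : IsStinespring Θ U) (h h' : H) (c c' : C) :
    inner ℂ c ((ptrace C D (Θ (ketbra h h'))).1 c') =
      inner ℂ (slice (HTensor D R) c' (hassoc C D R (U h')))
        (slice (HTensor D R) c (hassoc C D R (U h))) := by
  refine (hasSum_ptrace (stdBasis D) _ c c').unique
    ((hasSum_inner_slice (stdBasis D) _ _).congr_fun fun j => ?_)
  rw [hU.inner_ketbra, slice_slice_hassoc, slice_slice_hassoc]

/-- V acts away from C, so it commutes with slicing at c. The formula prescribes V on the vectors
(slice of UΨ x) ⊗ y. -/
theorem slice_sequential (V : HTensor Q B →L[ℂ] HTensor D R) (c : C) (x : A) (y : B) :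
    slice (HTensor D R) c (hassoc C D R (sequential UΨ V (htmul x y))) =
      V (htmul (slice Q c (UΨ x)) y) := by
  have h : hassoc C D R (sequential UΨ V (htmul x y)) =
      hmap (ContinuousLinearMap.id ℂ C) V (hassoc C Q B (htmul (UΨ x) y)) := by
    change hassoc C D R ((hassoc C D R).symm (hmap (ContinuousLinearMap.id ℂ C) V
      (hassoc C Q B (hmap UΨ (ContinuousLinearMap.id ℂ B) (htmul x y))))) = _
    rw [LinearIsometryEquiv.apply_symm_apply, hmap_htmul, ContinuousLinearMap.id_apply]
  rw [h, slice_hmap_id, slice_hassoc_htmul]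

theorem ptrace_comp_eq_of_sequential (hΦ : IsCPTP Φ) (hΨ : IsCPTP Ψ)
    (hUΦ : IsStinespring Φ UΦ) (hUΨ : IsStinespring Ψ UΨ)
    {V : HTensor Q B →ₗᵢ[ℂ] HTensor D R} (hV : UΦ = sequential UΨ V.toContinuousLinearMap) :
    ptrace C D ∘ₗ Φ = Ψ ∘ₗ ptrace A B := by
  refine (ptrace_comp_eq_iff hΦ hΨ).2 fun e e' f f' c c' => ?_
  rw [hUΦ.inner_ptrace_ketbra, hV, slice_sequential, slice_sequential, hUΨ.inner_ketbra,
    ← inner_htmul]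
  exact V.inner_map_map _ _

theorem exists_sequential [Nontrivial C] (hΦ : IsCPTP Φ) (hΨ : IsCPTP Ψ)
    (h : ptrace C D ∘ₗ Φ = Ψ ∘ₗ ptrace A B)
    (hUΦ : IsStinespring Φ UΦ) (hUΨ : IsMinimalStinespring Ψ UΨ) :
    ∃ V : HTensor Q B →ₗᵢ[ℂ] HTensor D R, UΦ = sequential UΨ V.toContinuousLinearMap := by
  rw [ptrace_comp_eq_iff hΦ hΨ] at h
  obtain ⟨V, hV⟩ := exists_linearIsometry_of_inner_eq
    (f := fun p : (C × A) × B => htmul (slice Q p.1.1 (UΨ p.1.2)) p.2)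
    (g := fun p : (C × A) × B => slice (HTensor D R) p.1.1 (hassoc C D R (UΦ (htmul p.1.2 p.2))))
    -- In Gram form, the causality condition is exactly the hypothesis that this isometry requires.
    (fun p q => by
      rw [← hUΦ.inner_ptrace_ketbra, h, inner_htmul, hUΨ.isStinespring.inner_ketbra])
    -- The first family is total: minimality makes the slices of UΨ total in Q, and B is tensored on
    -- in full.
    (by
      rw [← dense_span_htmul ((Submodule.dense_iff_topologicalClosure_eq_top).2
        (dense_slices_of_minimal hUΨ.minimal)) (T := Set.univ) (by simp)]
      congr 2
      ext z
      constructor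
      · rintro ⟨⟨p, y⟩, rfl⟩
        exact ⟨_, ⟨p, rfl⟩, y, trivial, rfl⟩
      · rintro ⟨_, ⟨p, rfl⟩, y, -, rfl⟩
        exact ⟨⟨p, y⟩, rfl⟩)
  refine ⟨V, ext_htmul fun x y => (hassoc C D R).injective (ext_slice fun c => ?_)⟩
  rw [slice_sequential]
  exact (hV ((c, x), y)).symm

theorem tfae_causality [Nontrivial C] (hΦ : IsCPTP Φ) (hΨ : IsCPTP Ψ) {α β : Type u}
    (a : HilbertBasis α ℂ A) (b : HilbertBasis β ℂ B) :
    List.TFAE [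
        ptrace C D ∘ₗ Φ = Ψ ∘ₗ ptrace A B,
        ∀ (ψA φA : A) (ψB φB : B) (ψC φC : C) (δ : Type u) (d : HilbertBasis δ ℂ D),
          HasSum
            (fun j => choi (tensorBasis a b) Φ
              (htmul ψC (d j) ⊗ₜ[ℂ] htmul ψA ψB) (htmul φC (d j) ⊗ₜ[ℂ] htmul φA φB))
            (choi a Ψ (ψC ⊗ₜ[ℂ] ψA) (φC ⊗ₜ[ℂ] φA) * inner ℂ ψB φB),
        ∀ (Q R : Type u)
          [NormedAddCommGroup Q] [InnerProductSpace ℂ Q] [CompleteSpace Q]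
          [NormedAddCommGroup R] [InnerProductSpace ℂ R] [CompleteSpace R]
          (UΦ : HTensor A B →L[ℂ] HTensor (HTensor C D) R) (UΨ : A →L[ℂ] HTensor C Q),
          IsMinimalStinespring Φ UΦ → IsMinimalStinespring Ψ UΨ →
          ∃ V : HTensor Q B →ₗᵢ[ℂ] HTensor D R,
            UΦ = sequential UΨ V.toContinuousLinearMap,
        ∃ (Q R : Type u)
          (_ : NormedAddCommGroup Q) (_ : InnerProductSpace ℂ Q) (_ : CompleteSpace Q)
          (_ : NormedAddCommGroup R) (_ : InnerProductSpace ℂ R) (_ : CompleteSpace R)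
          (UΦ : HTensor A B →L[ℂ] HTensor (HTensor C D) R) (UΨ : A →L[ℂ] HTensor C Q),
          IsMinimalStinespring Φ UΦ ∧ IsMinimalStinespring Ψ UΨ ∧
          ∃ V : HTensor Q B →ₗᵢ[ℂ] HTensor D R,
            UΦ = sequential UΨ V.toContinuousLinearMap] := by
  tfae_have 1 ↔ 2 := ptrace_comp_eq_iff_choi hΦ hΨ a b
  tfae_have 1 → 3 := by
    intro h Q R _ _ _ _ _ _ UΦ UΨ hUΦ hUΨ
    exact exists_sequential hΦ hΨ h hUΦ.isStinespring hUΨ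
  tfae_have 3 → 4 := by
    intro h
    obtain ⟨R, _, _, _, UΦ, hUΦ⟩ := exists_isMinimalStinespring hΦ
    obtain ⟨Q, _, _, _, UΨ, hUΨ⟩ := exists_isMinimalStinespring hΨ
    exact ⟨Q, R, _, _, ‹_›, _, _, ‹_›, UΦ, UΨ, hUΦ, hUΨ, h Q R UΦ UΨ hUΦ hUΨ⟩
  tfae_have 4 → 1 := by
    rintro ⟨Q, R, _, _, _, _, _, _, UΦ, UΨ, hUΦ, hUΨ, V, hV⟩
    exact ptrace_comp_eq_of_sequential hΦ hΨ hUΦ.isStinespring hUΨ.isStinespring hV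
  tfae_finish

end Causality

/-! ### Channels on spaces that are identified with tensor products -/

section Transport

variable {A B C D H K R : Type*}
  [NormedAddCommGroup A] [InnerProductSpace ℂ A] [CompleteSpace A]
  [NormedAddCommGroup B] [InnerProductSpace ℂ B] [CompleteSpace B]
  [NormedAddCommGroup C] [InnerProductSpace ℂ C] [CompleteSpace C]
  [NormedAddCommGroup D] [InnerProductSpace ℂ D] [CompleteSpace D]
  [NormedAddCommGroup H] [InnerProductSpace ℂ H] [CompleteSpace H]
  [NormedAddCommGroup K] [InnerProductSpace ℂ K] [CompleteSpace K]
  [NormedAddCommGroup R] [InnerProductSpace ℂ R] [CompleteSpace R]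

/-- A unitary as a bounded operator. -/
abbrev unitaryCLM (w : H ≃ₗᵢ[ℂ] K) : H →L[ℂ] K := w.toContinuousLinearEquiv.toContinuousLinearMap

theorem conjBy_symm_conjBy (w : H ≃ₗᵢ[ℂ] K) (ρ : traceClass H) :
    conjBy (unitaryCLM w.symm) (conjBy (unitaryCLM w) ρ) = ρ := by
  have h : unitaryCLM w.symm ∘L unitaryCLM w = ContinuousLinearMap.id ℂ H :=
    ContinuousLinearMap.ext w.symm_apply_apply
  rw [conjBy_comp, h]
  refine Subtype.ext (ContinuousLinearMap.ext fun v => ?_)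
  rw [conjBy_apply, ContinuousLinearMap.adjoint_id]
  rfl

theorem adjoint_unitaryCLM (w : H ≃ₗᵢ[ℂ] K) :
    ContinuousLinearMap.adjoint (unitaryCLM w) = unitaryCLM w.symm := by
  refine ContinuousLinearMap.ext fun v => ext_inner_right ℂ fun x => ?_
  rw [ContinuousLinearMap.adjoint_inner_left, ← w.inner_map_map (unitaryCLM w.symm v) x]
  exact congrArg (fun y => inner ℂ y (w x)) (w.apply_symm_apply v).symm

/-- The channel `Φ` between spaces that are identified with `H` and `K`. -/
def transport (wX : A ≃ₗᵢ[ℂ] H) (wY : C ≃ₗᵢ[ℂ] K) (Φ : traceClass H →ₗ[ℂ] traceClass K) :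
    traceClass A →ₗ[ℂ] traceClass C :=
  conjBy (unitaryCLM wY.symm) ∘ₗ Φ ∘ₗ conjBy (unitaryCLM wX)

theorem IsCPTP.transport {Φ : traceClass H →ₗ[ℂ] traceClass K} (hΦ : IsCPTP Φ)
    (wX : A ≃ₗᵢ[ℂ] H) (wY : C ≃ₗᵢ[ℂ] K) : IsCPTP (transport wX wY Φ) :=
  (isCPTP_conjBy wY.symm.inner_map_map).comp (hΦ.comp (isCPTP_conjBy wX.inner_map_map))

theorem inner_transport_ketbra (wX : A ≃ₗᵢ[ℂ] H) (wY : C ≃ₗᵢ[ℂ] K)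
    (Φ : traceClass H →ₗ[ℂ] traceClass K) (x x' : A) (y y' : C) :
    inner ℂ y ((transport wX wY Φ (ketbra x x')).1 y') =
      inner ℂ (wY y) ((Φ (ketbra (wX x) (wX x'))).1 (wY y')) := by
  change inner ℂ y ((conjBy (unitaryCLM wY.symm) (Φ (conjBy (unitaryCLM wX) (ketbra x x')))).1 y') =
    _
  rw [conjBy_ketbra, conjBy_apply, adjoint_unitaryCLM, ← wY.inner_map_map]
  exact congrArg (inner ℂ (wY y)) (wY.apply_symm_apply _)

theorem IsStinespring.transport {Φ : traceClass H →ₗ[ℂ] traceClass K} {U : H →L[ℂ] HTensor K R}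
    (hU : IsStinespring Φ U) (wX : A ≃ₗᵢ[ℂ] H) (wY : C ≃ₗᵢ[ℂ] K) :
    IsStinespring (transport wX wY Φ)
      (hmap (unitaryCLM wY.symm) (ContinuousLinearMap.id ℂ R) ∘L U ∘L unitaryCLM wX) := fun ρ => by
  change conjBy (unitaryCLM wY.symm) (Φ (conjBy (unitaryCLM wX) ρ)) = _
  rw [hU, conjBy_ptrace, conjBy_comp, conjBy_comp]
  rfl

theorem hmap_symm_hmap (w : C ≃ₗᵢ[ℂ] K) (z : HTensor C R) :
    hmap (unitaryCLM w.symm) (ContinuousLinearMap.id ℂ R)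
      (hmap (unitaryCLM w) (ContinuousLinearMap.id ℂ R) z) = z := by
  refine DFunLike.congr_fun (f := hmap (unitaryCLM w.symm) (ContinuousLinearMap.id ℂ R) ∘L
    hmap (unitaryCLM w) (ContinuousLinearMap.id ℂ R)) (g := ContinuousLinearMap.id ℂ _)
    (ext_htmul fun x y => ?_) z
  rw [ContinuousLinearMap.comp_apply, hmap_htmul, hmap_htmul]
  exact congrArg (htmul · y) (w.symm_apply_apply x)

/-- With S a `sequential` composite and wX, wY the wire splittings, the right side is the shape of
`wireSequential`. -/
theorem eq_hmap_comp_iff (wX : A ≃ₗᵢ[ℂ] H) (wY : C ≃ₗᵢ[ℂ] K) (U : H →L[ℂ] HTensor K R)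
    (S : A →L[ℂ] HTensor C R) :
    hmap (unitaryCLM wY.symm) (ContinuousLinearMap.id ℂ R) ∘L U ∘L unitaryCLM wX = S ↔
      U = hmap (unitaryCLM wY) (ContinuousLinearMap.id ℂ R) ∘L S ∘L unitaryCLM wX.symm := by
  constructor
  · rintro rfl
    refine ContinuousLinearMap.ext fun x => ?_
    change U x = hmap (unitaryCLM wY.symm.symm) (ContinuousLinearMap.id ℂ R)
      (hmap (unitaryCLM wY.symm) (ContinuousLinearMap.id ℂ R) (U (wX (wX.symm x))))
    rw [hmap_symm_hmap, wX.apply_symm_apply]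
  · rintro rfl
    refine ContinuousLinearMap.ext fun x => ?_
    change hmap (unitaryCLM wY.symm) (ContinuousLinearMap.id ℂ R)
      (hmap (unitaryCLM wY) (ContinuousLinearMap.id ℂ R) (S (wX.symm (wX x)))) = S x
    rw [hmap_symm_hmap, wX.symm_apply_apply]

theorem ptrace_comp_transport_iff (wX : HTensor A B ≃ₗᵢ[ℂ] H) (wY : HTensor C D ≃ₗᵢ[ℂ] K)
    (Φ : traceClass H →ₗ[ℂ] traceClass K) (Ψ : traceClass A →ₗ[ℂ] traceClass C) :
    ptrace C D ∘ₗ transport wX wY Φ = Ψ ∘ₗ ptrace A B ↔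
      (ptrace C D ∘ₗ conjBy (unitaryCLM wY.symm)) ∘ₗ Φ =
        Ψ ∘ₗ (ptrace A B ∘ₗ conjBy (unitaryCLM wX.symm)) := by
  constructor
  · intro h
    refine LinearMap.ext fun ρ => ?_
    have h1 := DFunLike.congr_fun h (conjBy (unitaryCLM wX.symm) ρ)
    change ptrace C D (conjBy (unitaryCLM wY.symm) (Φ (conjBy (unitaryCLM wX.symm.symm)
      (conjBy (unitaryCLM wX.symm) ρ)))) = _ at h1
    rw [conjBy_symm_conjBy] at h1
    exact h1
  · intro h
    refine LinearMap.ext fun ρ => (DFunLike.congr_fun h (conjBy (unitaryCLM wX) ρ)).trans ?_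
    change Ψ (ptrace A B (conjBy (unitaryCLM wX.symm) (conjBy (unitaryCLM wX) ρ))) = _
    rw [conjBy_symm_conjBy]
    rfl

/-- Choi forms depend on the basis used for conjugation, so wX must intertwine the two conjugations;
wY is unrestricted, since output vectors are not conjugated. -/
theorem choi_transport {α η : Type*} (a : HilbertBasis α ℂ A) (e : HilbertBasis η ℂ H)
    {wX : A ≃ₗᵢ[ℂ] H} (hw : ∀ x, conjVec e (wX x) = wX (conjVec a x)) (wY : C ≃ₗᵢ[ℂ] K)
    (Φ : traceClass H →ₗ[ℂ] traceClass K) (x x' : A) (y y' : C) :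
    choi a (transport wX wY Φ) (y ⊗ₜ[ℂ] x) (y' ⊗ₜ[ℂ] x') =
      choi e Φ (wY y ⊗ₜ[ℂ] wX x) (wY y' ⊗ₜ[ℂ] wX x') := by
  rw [choi_tmul, choi_tmul, inner_transport_ketbra, hw, hw]

end Transport

/-- The vacuum is a nonzero vector even over the empty set, so the requirement C ≠ 0 holds for every
wire, including the empty cut and dimension 0. -/
instance {S : Type*} : Nontrivial (Fock S) :=
  ⟨⟨fockBasis S 0, 0, (fockBasis S).orthonormal.ne_zero 0⟩⟩

/-- The splitting carries the product number basis to the number basis, relabelled by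
`multisetSplit`. -/
theorem conjVec_wireSplit {T : Type*} {P Q : Set T} (h : P ⊆ Q) (d : ℕ)
    (x : HTensor (Wire P d) (Wire (Q \ P : Set T) d)) :
    conjVec (fockBasis (Q × Fin d)) (wireSplit h d x) =
      wireSplit h d (conjVec (tensorBasis (fockBasis _) (fockBasis _)) x) := by
  refine conjVec_map _ _ (multisetSplit (splitPositions h d)) _ (fun p => ?_) x
  rw [tensorBasis_apply, fockBasis_apply, fockBasis_apply, fockBasis_apply, wireSplit,
    fockSplit_htmul]
  rfl

end CausalBox

end

/-! ### The equivalences for general channels and for causal boxes -/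

theorem mainTheorem7 :
    (∀ (A B C D : Type u)
      [NormedAddCommGroup A] [InnerProductSpace ℂ A] [CompleteSpace A]
      [NormedAddCommGroup B] [InnerProductSpace ℂ B] [CompleteSpace B]
      [NormedAddCommGroup C] [InnerProductSpace ℂ C] [CompleteSpace C] [Nontrivial C]
      [NormedAddCommGroup D] [InnerProductSpace ℂ D] [CompleteSpace D]
      (Φ : traceClass (HTensor A B) →ₗ[ℂ] traceClass (HTensor C D))
      (Ψ : traceClass A →ₗ[ℂ] traceClass C),
      IsCPTP Φ → IsCPTP Ψ →
      ∀ (α β : Type u) (a : HilbertBasis α ℂ A) (b : HilbertBasis β ℂ B),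
      List.TFAE [
        ptrace C D ∘ₗ Φ = Ψ ∘ₗ ptrace A B,
        ∀ (ψA φA : A) (ψB φB : B) (ψC φC : C) (δ : Type u) (d : HilbertBasis δ ℂ D),
          HasSum
            (fun j => choi (tensorBasis a b) Φ
              (htmul ψC (d j) ⊗ₜ[ℂ] htmul ψA ψB) (htmul φC (d j) ⊗ₜ[ℂ] htmul φA φB))
            (choi a Ψ (ψC ⊗ₜ[ℂ] ψA) (φC ⊗ₜ[ℂ] φA) * inner ℂ ψB φB),
        ∀ (Q R : Type u)
          [NormedAddCommGroup Q] [InnerProductSpace ℂ Q] [CompleteSpace Q]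
          [NormedAddCommGroup R] [InnerProductSpace ℂ R] [CompleteSpace R]
          (UΦ : HTensor A B →L[ℂ] HTensor (HTensor C D) R) (UΨ : A →L[ℂ] HTensor C Q),
          IsMinimalStinespring Φ UΦ → IsMinimalStinespring Ψ UΨ →
          ∃ V : HTensor Q B →ₗᵢ[ℂ] HTensor D R,
            UΦ = sequential UΨ V.toContinuousLinearMap,
        ∃ (Q R : Type u)
          (_ : NormedAddCommGroup Q) (_ : InnerProductSpace ℂ Q) (_ : CompleteSpace Q)
          (_ : NormedAddCommGroup R) (_ : InnerProductSpace ℂ R) (_ : CompleteSpace R)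
          (UΦ : HTensor A B →L[ℂ] HTensor (HTensor C D) R) (UΨ : A →L[ℂ] HTensor C Q),
          IsMinimalStinespring Φ UΦ ∧ IsMinimalStinespring Ψ UΨ ∧
          ∃ V : HTensor Q B →ₗᵢ[ℂ] HTensor D R,
            UΦ = sequential UΨ V.toContinuousLinearMap]) ∧
    (∀ (T : Type u) [PartialOrder T] [Countable T] (dX dY : ℕ)
      (χ : LowerSet T → LowerSet T)
      (hχ : IsCausalityFunction χ)
      (Φ : (C : BoundedCut T) →
        (traceClass (Wire (χ C.1 : Set T) dX) →ₗ[ℂ] traceClass (Wire (C.1 : Set T) dY))),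
      (∀ C, IsCPTP (Φ C)) →
      ∀ (C D : BoundedCut T) (h : C.1 ≤ D.1),
      let hX := hχ.coe_subset h
      let hY := LowerSet.coe_subset_coe.2 h
      List.TFAE [
        traceOut hY dY ∘ₗ Φ D = Φ C ∘ₗ traceOut hX dX,
        ∀ (ψX φX : Wire (χ C.1 : Set T) dX) (ψX' φX' : Wire (χ D.1 \ χ C.1 : Set T) dX)
          (ψY φY : Wire (C.1 : Set T) dY)
          (δ : Type u) (d : HilbertBasis δ ℂ (Wire (D.1 \ C.1 : Set T) dY)),
          HasSum
            (fun j => choi (fockBasis _) (Φ D)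
              (wireSplit hY dY (htmul ψY (d j)) ⊗ₜ[ℂ] wireSplit hX dX (htmul ψX ψX'))
              (wireSplit hY dY (htmul φY (d j)) ⊗ₜ[ℂ] wireSplit hX dX (htmul φX φX')))
            (choi (fockBasis _) (Φ C) (ψY ⊗ₜ[ℂ] ψX) (φY ⊗ₜ[ℂ] φX) * inner ℂ ψX' φX'),
        ∀ (Q R : Type u)
          [NormedAddCommGroup Q] [InnerProductSpace ℂ Q] [CompleteSpace Q]
          [NormedAddCommGroup R] [InnerProductSpace ℂ R] [CompleteSpace R]
          (UD : Wire (χ D.1 : Set T) dX →L[ℂ] HTensor (Wire (D.1 : Set T) dY) R)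
          (UC : Wire (χ C.1 : Set T) dX →L[ℂ] HTensor (Wire (C.1 : Set T) dY) Q),
          IsMinimalStinespring (Φ D) UD → IsMinimalStinespring (Φ C) UC →
          ∃ V : HTensor Q (Wire (χ D.1 \ χ C.1 : Set T) dX) →ₗᵢ[ℂ]
              HTensor (Wire (D.1 \ C.1 : Set T) dY) R,
            UD = wireSequential hX hY UC V.toContinuousLinearMap,
        ∃ (Q R : Type u)
          (_ : NormedAddCommGroup Q) (_ : InnerProductSpace ℂ Q) (_ : CompleteSpace Q)
          (_ : NormedAddCommGroup R) (_ : InnerProductSpace ℂ R) (_ : CompleteSpace R)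
          (UD : Wire (χ D.1 : Set T) dX →L[ℂ] HTensor (Wire (D.1 : Set T) dY) R)
          (UC : Wire (χ C.1 : Set T) dX →L[ℂ] HTensor (Wire (C.1 : Set T) dY) Q),
          IsMinimalStinespring (Φ D) UD ∧ IsMinimalStinespring (Φ C) UC ∧
          ∃ V : HTensor Q (Wire (χ D.1 \ χ C.1 : Set T) dX) →ₗᵢ[ℂ]
              HTensor (Wire (D.1 \ C.1 : Set T) dY) R,
            UD = wireSequential hX hY UC V.toContinuousLinearMap]) := by

  refine ⟨?_, ?_⟩
  · intro A B C D _ _ _ _ _ _ _ _ _ _ _ _ _ Φ Ψ hΦ hΨ α β a b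
    exact tfae_causality hΦ hΨ a b
  · intro T _ _ dX dY χ hχ Φ hΦ C D h hX hY
    -- Viewed through the splittings, Φ D is a channel between tensor products, and the lemma
    -- applies to it together with Φ C.
    have hΦ' := (hΦ D).transport (wireSplit hX dX) (wireSplit hY dY)
    have h1 := ptrace_comp_transport_iff (wireSplit hX dX) (wireSplit hY dY) (Φ D) (Φ C)
    tfae_have 1 ↔ 2 := by
      refine h1.symm.trans ((ptrace_comp_eq_iff_choi hΦ' (hΦ C) (fockBasis _)
        (fockBasis _)).trans ?_)
      simp_rw [choi_transport _ (fockBasis _) (conjVec_wireSplit hX dX)]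
    tfae_have 1 → 3 := by
      intro h0 Q R _ _ _ _ _ _ UD UC hUD hUC
      -- Only the representation of Φ C has to be minimal here, so minimality of UD need not be
      -- carried through the splitting.
      obtain ⟨V, hV⟩ := exists_sequential hΦ' (hΦ C) (h1.2 h0)
        (hUD.isStinespring.transport (wireSplit hX dX) (wireSplit hY dY)) hUC
      exact ⟨V, (eq_hmap_comp_iff _ _ _ _).1 hV⟩
    tfae_have 3 → 4 := by
      intro h0
      obtain ⟨R, _, _, _, UD, hUD⟩ := exists_isMinimalStinespring (hΦ D)
      obtain ⟨Q, _, _, _, UC, hUC⟩ := exists_isMinimalStinespring (hΦ C)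
      exact ⟨Q, R, _, _, ‹_›, _, _, ‹_›, UD, UC, hUD, hUC, h0 Q R UD UC hUD hUC⟩
    tfae_have 4 → 1 := by
      rintro ⟨Q, R, _, _, _, _, _, _, UD, UC, hUD, hUC, V, hV⟩
      exact h1.1 (ptrace_comp_eq_of_sequential hΦ' (hΦ C)
        (hUD.isStinespring.transport (wireSplit hX dX) (wireSplit hY dY)) hUC.isStinespring
        ((eq_hmap_comp_iff _ _ _ _).2 hV))
    tfae_finish
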